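/- **Setting.** A *convenient vector space* is a Hausdorff locally convex real vector space $\mathbb M$ that is $c^\infty$-complete (a curve $c:\mathbb R\to\mathbb M$ is smooth as soon as $\ell\circ c$ is smooth for every continuous linear $\ell$); a map between $c^\infty$-open sets is smooth if it maps smooth curves to smooth curves. Let $M$ be a manifold modelled on a convenient vector space $\mathbb M$, with a fixed atlas whose charts take values in $c^\infty$-open sets, with kinematic tangent bundle $TM$ and kinematic cotangent bundle $T'M$ (fibres: the bounded linear functionals on $T_xM$). Let $T^\flat M$ be a weak subbundle of $T'M$, i.e. a convenient vector bundle with fibres $T^\flat_xM\subset T'_xM$ whose inclusion in $T'M$ is a morphism of convenient bundles. For $U\subset M$ open, $\mathfrak A(U)$ is the set of $f\in C^\infty(U)$ such that, for all $k\ge 1$, $x\in U$ and $u_2,\dots,u_k\in T_xM$, one has $d^k_xf(\cdot,u_2,\dots,u_k)\in T^\flat_xM$ (derivatives taken in the charts of the atlas), this element of $T^\flat M$ depending smoothly on $(x,u_2,\dots,u_k)$. Assume that the differentials $d_xf$ of the functions $f\in\mathfrak A(U)$, $U$ an open neighbourhood of $x$, separate the points of $T_xM$, for every $x\in M$. **Partial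 Jacobi manifold.** Let $\Lambda$ be an alternating $2$-tensor on $T^\flat M$ that is admissible: there is a smooth bundle morphism $\Lambda^\sharp:T^\flat M\to TM$ with $\Lambda_x(\alpha,\beta)=\langle\beta,\Lambda^\sharp_x\alpha\rangle$ for $\alpha,\beta\in T_x^\flat M$. Let $E$ be a vector field on $M$. Suppose that for each open $U\subset M$ the derivations $D_\Lambda(f,g)=\Lambda(df,dg)$ and $f\mapsto E(f)$ map $\mathfrak A(U)\times\mathfrak A(U)$, respectively $\mathfrak A(U)$, to $\mathfrak A(U)$. Then $(M,\Lambda,E)$ is a *partial Jacobi manifold* if $$[\Lambda,\Lambda]=2\,E\wedge\Lambda,\qquad L_E\Lambda=0,$$ that is, for every open $U$ and all $f,g,h\in\mathfrak A(U)$, with $\circlearrowleft$ the sum over cyclic permutations of $(f,g,h)$, $$2\sum_{\circlearrowleft}\Lambda\big(d(\Lambda(df,dg)),dh\big)=2\sum_{\circlearrowleft}E(f)\,\Lambda(dg,dh),\qquad E(\Lambda(df,dg))=\Lambda(d(E f),dg)+\Lambda(df,d(E g)).$$ Its Jacobi bracket is $\{f,g\}=\Lambda(df,dg)+f\,E(g)-g\,E(f)$,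 and the Hamiltonian vector field of $f$ is $X_f=\Lambda^\sharp df+fE$. The *characteristic distribution* $\mathscr C$ is the distribution generated by the $X_f$, $f\in\mathfrak A(M)$, that is $\mathscr C_x=\operatorname{span}\{X_f(x): f\in\mathfrak A(M)\}$. **Proposition.** Let $(M,\Lambda,E)$ be a partial Jacobi manifold as above. 1. For every open $U\subset M$ and all $f,g\in\mathfrak A(U)$: $\{f,g\}\in\mathfrak A(U)$, $X_f$ is a smooth vector field on $U$, and $[X_f,X_g]=X_{\{f,g\}}$ on $U$. 2. The characteristic distribution $\mathscr C$ is involutive: for every open $U\subset M$, the $C^\infty(U)$-module of vector fields on $U$ generated by the (restrictions of the) Hamiltonian vector fields $X_f$, $f\in\mathfrak A(M)$, is closed under the Lie bracket; in particular the brackets of its elements are tangent to $\mathscr C$. -/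

import Mathlib

open Filter Topology

noncomputable section

namespace Convenient

/-! ### Convenient vector spaces and smooth maps -/

section Calculus

variable {E : Type*} [AddCommGroup E] [Module ℝ E] [TopologicalSpace E]
variable {F : Type*} [AddCommGroup F] [Module ℝ F] [TopologicalSpace F]

/-- The curve `c` has derivative `v` at `t`: its difference quotients converge to `v`. -/
def HasCurveDerivAt (c : ℝ → E) (v : E) (t : ℝ) : Prop :=
  Tendsto (fun s : ℝ => s⁻¹ • (c (t + s) - c t)) (𝓝[≠] 0) (𝓝 v)

/-- A curve is smooth if all its iterated derivatives exist. -/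
def SmoothCurve (c : ℝ → E) : Prop :=
  ∃ d : ℕ → ℝ → E, d 0 = c ∧ ∀ n t, HasCurveDerivAt (d n) (d (n + 1) t) t

/-- The directional derivative `df(x)(v)`. -/
def dirDeriv (f : E → F) (x v : E) : F :=
  limUnder (𝓝[≠] (0 : ℝ)) (fun s : ℝ => s⁻¹ • (f (x + s • v) - f x))

/-- The iterated directional derivative; `iterDeriv g [u₁, …, uₖ] x` is
`dᵏg(x)(u₁, …, uₖ)`. -/
def iterDeriv (g : E → F) : List E → E → F
  | [] => g
  | u :: us => fun x => dirDeriv (iterDeriv g us) x u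

/-- A map is smooth on `s` if it sends smooth curves in `s` to smooth curves. -/
def SmoothOn (f : E → F) (s : Set E) : Prop :=
  ∀ c : ℝ → E, SmoothCurve c → (∀ t, c t ∈ s) → SmoothCurve (fun t => f (c t))

end Calculus

/-- A convenient (`c^∞`-complete) vector space: a Hausdorff locally convex space in which every
curve that is smooth when tested with the continuous linear functionals is smooth. -/
class ConvenientSpace (E : Type*) [AddCommGroup E] [Module ℝ E] [TopologicalSpace E] : Prop
    extends IsTopologicalAddGroup E, ContinuousSMul ℝ E, LocallyConvexSpace ℝ E, T2Space E where
  smooth_of_scalarwise : ∀ c : ℝ → E,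
    (∀ l : E →L[ℝ] ℝ, ContDiff ℝ (⊤ : ℕ∞) (fun t => l (c t))) → SmoothCurve c

/-- A copy of `E` that carries the `c^∞`-topology in place of the locally convex one. -/
def CInf (E : Type*) : Type _ := E

/-- The identity map `E → CInf E`. -/
def CInf.of {E : Type*} (y : E) : CInf E := y

/-- The identity map `CInf E → E`. -/
def CInf.val {E : Type*} (y : CInf E) : E := y

/-- The `c^∞`-topology: the final topology with respect to all smooth curves. -/
instance CInf.instTopologicalSpace (E : Type*) [AddCommGroup E] [Module ℝ E]
    [TopologicalSpace E] : TopologicalSpace (CInf E) where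
  IsOpen s := ∀ c : ℝ → E, SmoothCurve c → IsOpen ((fun t => CInf.of (c t)) ⁻¹' s)
  isOpen_univ := fun _ _ => isOpen_univ
  isOpen_inter := fun _ _ hs ht c hc => (hs c hc).inter (ht c hc)
  isOpen_sUnion := fun S hS c hc => by
    rw [Set.preimage_sUnion]
    exact isOpen_biUnion fun s hs => hS s hs c hc

/-! ### Convenient manifolds -/

section Manifold

variable {E : Type*} [AddCommGroup E] [Module ℝ E] [TopologicalSpace E]
variable {M : Type*} [TopologicalSpace M]

/-- A chart, read as a map into `E`. -/
def coord (e : OpenPartialHomeomorph M (CInf E)) (x : M) : E := (e x).val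

/-- The inverse of a chart, read as a map on `E`. -/
def point (e : OpenPartialHomeomorph M (CInf E)) (y : E) : M := e.symm (CInf.of y)

/-- The subset of the model space `E` that corresponds to `U` in the chart `e`. -/
def chartSet (e : OpenPartialHomeomorph M (CInf E)) (U : Set M) : Set E :=
  {y | CInf.of y ∈ e.target ∧ point e y ∈ U}

variable (E M) in
/-- A convenient manifold modelled on `E`: its charts take values in `c^∞`-open subsets of `E`
and its changes of charts are smooth. -/
class ConvenientManifold [ChartedSpace (CInf E) M] : Prop where
  smooth_transition : ∀ e ∈ atlas (CInf E) M, ∀ e' ∈ atlas (CInf E) M,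
    SmoothOn (fun y => coord e' (point e y)) (chartSet e e'.source)

variable [ChartedSpace (CInf E) M]

/-! The kinematic tangent space at `x` is `E`, a kinematic tangent vector being identified with
its coordinate vector in the preferred chart `chartAt (CInf E) x`. -/

/-- The coordinates in the chart `e` of the tangent vector `v` at `x`. -/
def toChart (e : OpenPartialHomeomorph M (CInf E)) (x : M) (v : E) : E :=
  dirDeriv (fun y => coord e (point (chartAt (CInf E) x) y)) (coord (chartAt (CInf E) x) x) v

/-- The tangent vector at `x` whose coordinates in the chart `e` are `v`. -/
def ofChart (e : OpenPartialHomeomorph M (CInf E)) (x : M) (v : E) : E :=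
  dirDeriv (fun y => coord (chartAt (CInf E) x) (point e y)) (coord e x) v

variable (E) in
/-- Smooth real functions on `U`. -/
def SmoothFun (U : Set M) (f : M → ℝ) : Prop :=
  ∀ e ∈ atlas (CInf E) M, SmoothOn (fun y : E => f (point e y)) (chartSet e U)

/-- The differential `df_x`, a function on the tangent space at `x`. -/
def diff (f : M → ℝ) (x : M) (v : E) : ℝ :=
  dirDeriv (fun y => f (point (chartAt (CInf E) x) y)) (coord (chartAt (CInf E) x) x) v

/-- The function `dᵏf(·, u₂, …, uₖ)` on the tangent space at `x`, the derivative of order `k` being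
taken in the chart `e` and `us = [u₂, …, uₖ]`. -/
def jetCovector (e : OpenPartialHomeomorph M (CInf E)) (f : M → ℝ) (us : List E) (x : M)
    (v : E) : ℝ :=
  iterDeriv (fun y => f (point e y)) (toChart e x v :: us) (coord e x)

/-- The local representative in the chart `e` of a field `X` of tangent vectors. -/
def chartRep (e : OpenPartialHomeomorph M (CInf E)) (X : M → E) (y : E) : E :=
  toChart e (point e y) (X (point e y))

/-- `X` is a (smooth, kinematic) vector field on `U`. -/
def IsVectorFieldOn (U : Set M) (X : M → E) : Prop :=
  ∀ e ∈ atlas (CInf E) M, SmoothOn (chartRep e X) (chartSet e U)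

/-- The function `X(f) = df(X)`. -/
def fieldApply (X : M → E) (f : M → ℝ) (x : M) : ℝ := diff f x (X x)

/-- The Lie bracket of vector fields: `[X, Y] = dY(X) - dX(Y)` in a chart. -/
def lieBracket (X Y : M → E) (x : M) : E :=
  dirDeriv (chartRep (chartAt (CInf E) x) Y) (coord (chartAt (CInf E) x) x) (X x) -
    dirDeriv (chartRep (chartAt (CInf E) x) X) (coord (chartAt (CInf E) x) x) (Y x)

end Manifold

/-! ### Weak subbundles of the kinematic cotangent bundle -/

/-- The space of bounded linear functionals on `E`; it is the kinematic cotangent space. -/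
def cotangent (E : Type*) [AddCommGroup E] [Module ℝ E] [TopologicalSpace E]
    [IsTopologicalAddGroup E] [ContinuousSMul ℝ E] : Submodule ℝ (E → ℝ) where
  carrier := {α | IsLinearMap ℝ α ∧
    ∀ s : Set E, Bornology.IsVonNBounded ℝ s → Bornology.IsVonNBounded ℝ (α '' s)}
  zero_mem' := ⟨⟨fun _ _ => by simp, fun _ _ => by simp⟩, fun s _ =>
    (Bornology.isVonNBounded_singleton (𝕜 := ℝ) (0 : ℝ)).subset
      (by rintro _ ⟨x, _, rfl⟩; simp)⟩
  add_mem' := fun {a b} ha hb =>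
    ⟨⟨fun x y => by simp only [Pi.add_apply, ha.1.map_add, hb.1.map_add]; ring,
      fun c x => by simp only [Pi.add_apply, ha.1.map_smul, hb.1.map_smul, smul_add]⟩,
      fun s hs => ((ha.2 s hs).add (hb.2 s hs)).subset (by
        rintro _ ⟨x, hx, rfl⟩
        exact Set.add_mem_add ⟨x, hx, rfl⟩ ⟨x, hx, rfl⟩)⟩
  smul_mem' := fun r {a} ha =>
    ⟨⟨fun x y => by simp only [Pi.smul_apply, ha.1.map_add, smul_add],
      fun c x => by simp only [Pi.smul_apply, ha.1.map_smul, smul_eq_mul]; ring⟩,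
      fun s hs => ((ha.2 s hs).image (r • ContinuousLinearMap.id ℝ ℝ)).subset (by
        rintro _ ⟨x, hx, rfl⟩
        exact ⟨a x, ⟨x, hx, rfl⟩, by simp⟩)⟩

/-- A weak subbundle `T^♭M` of the kinematic cotangent bundle, with typical fibre the convenient
space `F`: a convenient vector bundle whose fibres are subspaces of the kinematic cotangent spaces,
such that the inclusion is a (smooth) bundle morphism. Local trivializations are given by
linear parametrizations `param p x : F → T^♭_x M` for `x` in an open neighbourhood of `p`. -/
structure WeakSubbundle (E : Type*) [AddCommGroup E] [Module ℝ E] [TopologicalSpace E]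
    [ConvenientSpace E] (M : Type*) [TopologicalSpace M] [ChartedSpace (CInf E) M]
    (F : Type*) [AddCommGroup F] [Module ℝ F] [TopologicalSpace F] [ConvenientSpace F] where
  fiber : M → Submodule ℝ (E → ℝ)
  fiber_le : ∀ x, fiber x ≤ cotangent E
  baseSet : M → Set M
  isOpen_baseSet : ∀ p, IsOpen (baseSet p)
  mem_baseSet : ∀ p, p ∈ baseSet p
  param : M → M → F →ₗ[ℝ] (E → ℝ)
  param_injective : ∀ p, ∀ x ∈ baseSet p, Function.Injective (param p x)
  range_param : ∀ p, ∀ x ∈ baseSet p, LinearMap.range (param p x) = fiber x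
  /-- The changes of trivialization are smooth. -/
  smooth_change : ∀ p q : M, ∀ e ∈ atlas (CInf E) M, ∀ (y : ℝ → E) (φ ψ : ℝ → F),
    SmoothCurve y → (∀ t, y t ∈ chartSet e (baseSet p ∩ baseSet q)) → SmoothCurve φ →
    (∀ t, param q (point e (y t)) (ψ t) = param p (point e (y t)) (φ t)) → SmoothCurve ψ
  /-- The inclusion is smooth. -/
  smooth_incl : ∀ p : M, ∀ e ∈ atlas (CInf E) M, ∀ (y v : ℝ → E) (φ : ℝ → F),
    SmoothCurve y → (∀ t, y t ∈ chartSet e (baseSet p)) → SmoothCurve v → SmoothCurve φ →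
    SmoothCurve (fun t => param p (point e (y t)) (φ t) (ofChart e (point e (y t)) (v t)))

section Jacobi

variable {E : Type*} [AddCommGroup E] [Module ℝ E] [TopologicalSpace E] [ConvenientSpace E]
variable {M : Type*} [TopologicalSpace M] [ChartedSpace (CInf E) M]
variable {F : Type*} [AddCommGroup F] [Module ℝ F] [TopologicalSpace F] [ConvenientSpace F]

/-- The algebra `𝔄(U)`: smooth functions on `U` all of whose derivatives `dᵏf(·, u₂, …, uₖ)`,
`k ≥ 1`, lie in `T^♭M` and depend smoothly, as elements of `T^♭M`, on the point and on
`u₂, …, uₖ`. -/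
structure MemA (T : WeakSubbundle E M F) (U : Set M) (f : M → ℝ) : Prop where
  smooth : SmoothFun E U f
  mem : ∀ e ∈ atlas (CInf E) M, ∀ x ∈ U ∩ e.source, ∀ us : List E,
    jetCovector e f us x ∈ T.fiber x
  smooth_jet : ∀ p : M, ∀ e ∈ atlas (CInf E) M,
    ∀ (m : ℕ) (y : ℝ → E) (u : Fin m → ℝ → E) (ψ : ℝ → F),
    SmoothCurve y → (∀ t, y t ∈ chartSet e (U ∩ T.baseSet p)) → (∀ i, SmoothCurve (u i)) →
    (∀ t, T.param p (point e (y t)) (ψ t) =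
      jetCovector e f (List.ofFn fun i => u i t) (point e (y t))) →
    SmoothCurve ψ

/-- The differentials at `x` of the functions in `𝔄(U)`, `U` an open neighbourhood of `x`, separate
the tangent vectors at `x`. -/
def WeakSubbundle.Separating (T : WeakSubbundle E M F) : Prop :=
  ∀ (x : M) (v : E),
    (∀ U : Set M, IsOpen U → x ∈ U → ∀ f : M → ℝ, MemA T U f → diff f x v = 0) → v = 0

open Classical in
/-- A linear map on `T^♭_x M`, extended by `0` to all functions on the tangent space. -/
def extendSharp (T : WeakSubbundle E M F) (sharp : (x : M) → T.fiber x →ₗ[ℝ] E) (x : M)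
    (α : E → ℝ) : E :=
  if h : α ∈ T.fiber x then sharp x ⟨α, h⟩ else 0

variable (E M F) in
/-- A weak subbundle `T^♭M` with an admissible alternating `2`-tensor `Λ` on it. It is given by the
bundle morphism `Λ^♯ : T^♭M → TM`, and `Λ(α, β) = ⟨β, Λ^♯ α⟩`. -/
structure AdmissibleBivector where
  bundle : WeakSubbundle E M F
  sharp : (x : M) → bundle.fiber x →ₗ[ℝ] E
  smooth_sharp : ∀ p : M, ∀ e ∈ atlas (CInf E) M, ∀ (y : ℝ → E) (φ : ℝ → F),
    SmoothCurve y → (∀ t, y t ∈ chartSet e (bundle.baseSet p)) → SmoothCurve φ →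
    SmoothCurve (fun t => toChart e (point e (y t))
      (extendSharp bundle sharp (point e (y t)) (bundle.param p (point e (y t)) (φ t))))
  alternating : ∀ (x : M) (α : bundle.fiber x), (α : E → ℝ) (sharp x α) = 0

namespace AdmissibleBivector

variable (L : AdmissibleBivector E M F)

/-- The field `Λ^♯ df`. -/
def sharpD (f : M → ℝ) (x : M) : E := extendSharp L.bundle L.sharp x (diff f x)

/-- The derivation `D_Λ(f, g) = Λ(df, dg)`. -/
def apply (f g : M → ℝ) (x : M) : ℝ := diff g x (L.sharpD f x)

end AdmissibleBivector

/-- `D ∘ D'` for two `2`-alternating derivations: the signed sum over the `(2,1)`-shuffles. -/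
def derivComp (D D' : (M → ℝ) → (M → ℝ) → M → ℝ) (f₁ f₂ f₃ : M → ℝ) : M → ℝ :=
  D (D' f₁ f₂) f₃ - D (D' f₁ f₃) f₂ + D (D' f₂ f₃) f₁

/-- The Schouten bracket `[D, D'] = D ∘ D' - (-1)^{(2-1)(2-1)} D' ∘ D` of `2`-alternating
derivations. -/
def schouten (D D' : (M → ℝ) → (M → ℝ) → M → ℝ) (f₁ f₂ f₃ : M → ℝ) : M → ℝ :=
  derivComp D D' f₁ f₂ f₃ + derivComp D' D f₁ f₂ f₃

/-- The exterior product of a derivation and a `2`-alternating derivation: the signed sum over the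
`(1,2)`-shuffles. -/
def wedge (D : (M → ℝ) → M → ℝ) (D' : (M → ℝ) → (M → ℝ) → M → ℝ) (f₁ f₂ f₃ : M → ℝ) : M → ℝ :=
  D f₁ * D' f₂ f₃ - D f₂ * D' f₁ f₃ + D f₃ * D' f₁ f₂

/-- The Lie derivative `(L_X Λ)(df, dg)`. -/
def lieDeriv (D : (M → ℝ) → M → ℝ) (D' : (M → ℝ) → (M → ℝ) → M → ℝ) (f g : M → ℝ) : M → ℝ :=
  D (D' f g) - D' (D f) g - D' f (D g)

variable (E M F) in
/-- A partial Jacobi manifold `(M, Λ, X)`. -/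
structure PartialJacobi extends AdmissibleBivector E M F where
  reeb : M → E
  reeb_smooth : IsVectorFieldOn Set.univ reeb
  /-- `f ↦ X(f)` is a derivation of `𝔄(U)`. -/
  reeb_mem : ∀ U : Set M, IsOpen U → ∀ f, MemA bundle U f → MemA bundle U (fieldApply reeb f)
  /-- `(f, g) ↦ Λ(df, dg)` is a derivation of `𝔄(U)`. -/
  apply_mem : ∀ U : Set M, IsOpen U → ∀ f g, MemA bundle U f → MemA bundle U g →
    MemA bundle U (toAdmissibleBivector.apply f g)
  /-- `[Λ, Λ] = 2 X ∧ Λ`. -/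
  schouten_eq : ∀ U : Set M, IsOpen U → ∀ f g h, MemA bundle U f → MemA bundle U g →
    MemA bundle U h → ∀ x ∈ U,
    schouten toAdmissibleBivector.apply toAdmissibleBivector.apply f g h x =
      2 * wedge (fieldApply reeb) toAdmissibleBivector.apply f g h x
  /-- `L_X Λ = 0`. -/
  lieDeriv_eq : ∀ U : Set M, IsOpen U → ∀ f g, MemA bundle U f → MemA bundle U g → ∀ x ∈ U,
    lieDeriv (fieldApply reeb) toAdmissibleBivector.apply f g x = 0

namespace PartialJacobi

variable (J : PartialJacobi E M F)

/-- The Jacobi bracket `{f, g} = Λ(df, dg) + f X(g) - g X(f)`. -/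
def bracket (f g : M → ℝ) : M → ℝ :=
  J.apply f g + f * fieldApply J.reeb g - g * fieldApply J.reeb f

/-- The Hamiltonian vector field `X_f = Λ^♯ df + f X`. -/
def hamiltonian (f : M → ℝ) (x : M) : E := J.sharpD f x + f x • J.reeb x

/-- The Hamiltonian vector fields `X_f`, `f ∈ 𝔄(M)`; they generate the characteristic distribution
of the partial Jacobi manifold. -/
def hamiltonianFields : Set (M → E) :=
  {X | ∃ f : M → ℝ, MemA J.bundle Set.univ f ∧ X = J.hamiltonian f}

end PartialJacobi

/-! ### Distributions generated by vector fields -/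

/-- The distribution generated by a set `G` of vector fields. -/
def generatedDistribution (G : Set (M → E)) (x : M) : Submodule ℝ E :=
  Submodule.span ℝ {v | ∃ X ∈ G, X x = v}

/-- On `U`, the field `Y` belongs to the `C^∞(U)`-module generated by `G`. -/
def IsGeneratedSection (G : Set (M → E)) (U : Set M) (Y : M → E) : Prop :=
  ∃ (n : ℕ) (h : Fin n → M → ℝ) (X : Fin n → M → E),
    (∀ i, SmoothFun E U (h i)) ∧ (∀ i, X i ∈ G) ∧ ∀ x ∈ U, Y x = ∑ i, h i x • X i x

/-- The distribution generated by `G` is involutive: over every open set, the brackets of sections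
generated by `G` are sections generated by `G`, and so are tangent to the distribution. -/
def IsInvolutive (G : Set (M → E)) : Prop :=
  ∀ U : Set M, IsOpen U → ∀ Y Z : M → E, IsGeneratedSection G U Y → IsGeneratedSection G U Z →
    IsGeneratedSection G U (lieBracket Y Z) ∧
      ∀ x ∈ U, lieBracket Y Z x ∈ generatedDistribution G x

end Jacobi

end Convenient

end

open Filter Topology
noncomputable section
namespace Convenient
open scoped ContDiff

/-! ### Curves through fast converging sequences -/

/-! The geometric argument is short. A commutator of vector fields acts on a function `h` as the
commutator of the two derivations, so after testing against `dh`, `h ∈ 𝔄(V)`, the formula `[X_f,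
X_g] = X_{f,g}` becomes an identity between real functions. Expanded with the product rule, it is a
linear combination of the Schouten identity for `(f, g, h)`, of `L_E Λ = 0` for `(g, h)` and `(f,
h)`, and of the skew-symmetry of `Λ` (`diff_lieBracket_hamiltonian`). Since the differentials
separate tangent vectors, the vector identity follows. The bracket stays in `𝔄(U)` because `𝔄(U)` is
an algebra (`MemA.mul`, a Leibniz rule for jets) that `Λ` and `E` preserve. Involutivity is then the
Leibniz rule for brackets of combinations `∑ hᵢ Xᵢ` (`lieBracket_eq_sum`), because `{f, g}` again
belongs to `𝔄(M)`.

What costs work is the calculus. Smoothness only means smoothness along smooth curves, and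
derivatives are only directional limits. Linearity of the differential, the chain rule, the symmetry
of second derivatives and the smooth dependence of derivatives on their arguments are all statements
about a function restricted to a two-parameter surface. There Boman's theorem
(`contDiffAt_of_curve`) turns smoothness along curves into ordinary smoothness on the plane.

Boman's theorem itself rests on two points. A smooth curve can be led through any sufficiently fast
converging sequence, which forces continuity and local bounds on the pure partial derivatives of
every order. For a compactly supported function such bounds make the Fourier transform decrease
faster than every power, and Fourier inversion then gives smoothness. -/

/-- A series of spikes, the `k`-th one being located at `2⁻ᵏ`. -/
def spikeSeries (φ : ℝ → ℝ) (a : ℕ → ℝ) (t : ℝ) : ℝ :=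
  ∑' k : ℕ, a k / (k.factorial : ℝ) * φ (8 * (2 ^ k * t - 1))

theorem iteratedDeriv_spike {φ : ℝ → ℝ} (hφ : ContDiff ℝ ∞ φ) (c b d : ℝ) (n : ℕ) (t : ℝ) :
    iteratedDeriv n (fun t => c * φ (b * t + d)) t = c * (b ^ n * iteratedDeriv n φ (b * t + d)) := by
  have h1 : ContDiff ℝ n (fun t => φ (t + d)) :=
    (hφ.of_le (by exact_mod_cast le_top)).comp (contDiff_id.add contDiff_const)
  have h2 := iteratedDeriv_comp_const_mul h1 b
  have h3 := iteratedDeriv_comp_add_const n φ d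
  rw [iteratedDeriv_const_mul_field, h2]
  simp [h3]

/-- The `n`-th derivative of the `k`-th term is at most `Cₙ 8ⁿ (2ⁿ)ᵏ / k!`. The factorial beats the
geometric growth caused by the narrowing of the spikes, so the series may be differentiated term by
term. -/
theorem contDiff_spikeSeries {φ : ℝ → ℝ} (hφ : ContDiff ℝ ∞ φ) (hs : HasCompactSupport φ)
    {a : ℕ → ℝ} (ha : ∀ k, |a k| ≤ 1) : ContDiff ℝ ∞ (spikeSeries φ a) := by
  have hb : ∀ n : ℕ, ∃ C, ∀ x, ‖iteratedDeriv n φ x‖ ≤ C := fun n => by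
    refine (hφ.continuous_iteratedDeriv n (by exact_mod_cast le_top)).bounded_above_of_compact_support ?_
    have := hs.iteratedFDeriv (𝕜 := ℝ) n
    rw [iteratedDeriv_eq_equiv_comp]
    exact this.comp_left (by simp)
  choose C hC using hb
  unfold spikeSeries
  refine contDiff_tsum (N := ⊤) (v := fun n k => C n * 8 ^ n * ((2 ^ n) ^ k / (k.factorial : ℝ)))
    (fun k => ?_) (fun n _ => ?_) (fun n k t _ => ?_)
  · exact contDiff_const.mul (hφ.comp (by fun_prop))
  · exact (Real.summable_pow_div_factorial _).mul_left _
  · rw [norm_iteratedFDeriv_eq_norm_iteratedDeriv]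
    have he : (fun t => a k / (k.factorial : ℝ) * φ (8 * (2 ^ k * t - 1))) =
        fun t => a k / (k.factorial : ℝ) * φ ((8 * 2 ^ k) * t + (-8)) := by
      funext t; congr 2; ring
    rw [he, iteratedDeriv_spike hφ, norm_mul, norm_mul, norm_div, Real.norm_eq_abs (a k)]
    have h0 : (0 : ℝ) < (k.factorial : ℝ) := by exact_mod_cast k.factorial_pos
    have h1 : ‖((8 : ℝ) * 2 ^ k) ^ n‖ = 8 ^ n * (2 ^ n) ^ k := by
      rw [Real.norm_of_nonneg (by positivity), mul_pow, ← pow_mul, ← pow_mul, mul_comm k n]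
    have h2 : ‖(k.factorial : ℝ)‖ = k.factorial := Real.norm_of_nonneg h0.le
    rw [h1, h2]
    calc |a k| / (k.factorial : ℝ) * (8 ^ n * (2 ^ n) ^ k * ‖iteratedDeriv n φ _‖)
        ≤ 1 / (k.factorial : ℝ) * (8 ^ n * (2 ^ n) ^ k * C n) := by
          gcongr
          · exact ha k
          · exact hC n _
      _ = _ := by ring

/-- Near `2⁻ᵏ` the rescaled variable of every other spike lies outside `(-2, 2)`, so a profile
supported in `[-2, 2]` contributes only its `k`-th spike there. -/
theorem two_le_abs_spike {j k : ℕ} (hjk : j ≠ k) {t : ℝ} (ht : |2 ^ k * t - 1| < 1 / 8) :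
    2 ≤ |8 * ((2 : ℝ) ^ j * t - 1)| := by
  rw [abs_lt] at ht
  rcases lt_or_gt_of_ne hjk with h | h
  · obtain ⟨m, rfl⟩ := Nat.exists_eq_add_of_lt h
    have h1 : (2 : ℝ) ^ (j + m + 1) = 2 ^ j * 2 ^ m * 2 := by ring
    have h2 : (1 : ℝ) ≤ 2 ^ m := one_le_pow₀ (by norm_num)
    rw [h1] at ht
    have h3 : 0 ≤ (2 : ℝ) ^ j * t := by
      have : 0 < ((2 : ℝ) ^ m * 2) * (2 ^ j * t) := by nlinarith
      exact (pos_of_mul_pos_right this (by positivity)).le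
    have h4 : (2 : ℝ) ^ j * t ≤ 2 ^ j * t * 2 ^ m := le_mul_of_one_le_right h3 h2
    rw [le_abs]; right
    nlinarith
  · obtain ⟨m, rfl⟩ := Nat.exists_eq_add_of_lt h
    have h1 : (2 : ℝ) ^ (k + m + 1) * t = (2 ^ k * t) * 2 ^ m * 2 := by ring
    have h2 : (1 : ℝ) ≤ 2 ^ m := one_le_pow₀ (by norm_num)
    rw [le_abs]; left
    rw [h1]
    nlinarith

theorem spikeSeries_eq {φ : ℝ → ℝ} (h0 : ∀ u, 2 ≤ |u| → φ u = 0) (a : ℕ → ℝ) (k : ℕ) {t : ℝ}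
    (ht : |2 ^ k * t - 1| < 1 / 8) :
    spikeSeries φ a t = a k / (k.factorial : ℝ) * φ (8 * (2 ^ k * t - 1)) :=
  tsum_eq_single k fun j hj => by rw [h0 _ (two_le_abs_spike hj ht), mul_zero]

theorem spikeSeries_zero {φ : ℝ → ℝ} (h0 : ∀ u, 2 ≤ |u| → φ u = 0) (a : ℕ → ℝ) :
    spikeSeries φ a 0 = 0 := by
  unfold spikeSeries
  convert tsum_zero with k
  rw [h0, mul_zero]
  norm_num

/-- A smooth curve through a fast converging sequence in the plane, whose velocity at the `k`-th
point is horizontal. -/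
theorem exists_curve_through {p : ℕ → ℝ × ℝ} {q : ℝ × ℝ}
    (hp : ∀ k, ‖p k - q‖ ≤ 1 / (k.factorial : ℝ)) :
    ∃ c : ℝ → ℝ × ℝ, ContDiff ℝ ∞ c ∧ c 0 = q ∧ ∀ k t, |2 ^ k * t - 1| < 1 / 8 →
      c t = p k + (8 * (2 ^ k * t - 1) / (k.factorial : ℝ), 0) := by
  -- The bump is `1` on `[-1, 1]`, which is where `8 (2 ^ k * t - 1)` ranges when `|2 ^ k * t - 1| <
  -- 1 / 8`, and vanishes from distance `2` on.
  let φ : ContDiffBump (0 : ℝ) := ⟨1, 2, one_pos, by norm_num⟩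
  have hφ : ContDiff ℝ ∞ φ := φ.contDiff
  have hφ0 : ∀ u, 2 ≤ |u| → φ u = 0 := fun u hu =>
    φ.zero_of_le_dist (by simpa [Real.dist_eq] using hu)
  have hφ1 : ∀ u, |u| ≤ 1 → φ u = 1 := fun u hu =>
    φ.one_of_mem_closedBall (by simpa using hu)
  have hψ : ContDiff ℝ ∞ (fun u => u * φ u) := contDiff_id.mul hφ
  have hψ0 : ∀ u, 2 ≤ |u| → u * φ u = 0 := fun u hu => by rw [hφ0 u hu, mul_zero]
  have hfac : ∀ k : ℕ, (0 : ℝ) < k.factorial := fun k => by exact_mod_cast k.factorial_pos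
  have key : ∀ x : ℝ, ∀ k : ℕ, |x| ≤ 1 / (k.factorial : ℝ) → |x * k.factorial| ≤ 1 := by
    intro x k hx
    rw [abs_mul, abs_of_pos (hfac k)]
    calc |x| * k.factorial ≤ 1 / (k.factorial : ℝ) * k.factorial := by
          gcongr
      _ = 1 := by field_simp [(hfac k).ne']
  -- The factor `k!` cancels the denominator in `spikeSeries`; the assumed speed of convergence
  -- keeps the coefficients bounded by `1`.
  let α : ℕ → ℝ := fun k => (p k - q).1 * k.factorial
  let β : ℕ → ℝ := fun k => (p k - q).2 * k.factorial
  have hα : ∀ k, |α k| ≤ 1 := fun k => key _ _ ((norm_fst_le (p k - q)).trans (hp k))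
  have hβ : ∀ k, |β k| ≤ 1 := fun k => key _ _ ((norm_snd_le (p k - q)).trans (hp k))
  -- The plateaus of `φ` carry `q` to `p k`. The profile `u * φ u`, with all coefficients `1`, adds
  -- the horizontal motion.
  refine ⟨fun t => (q.1 + (spikeSeries φ α t + spikeSeries (fun u => u * φ u) 1 t),
    q.2 + spikeSeries φ β t), ?_, ?_, ?_⟩
  · refine ContDiff.prodMk (contDiff_const.add (ContDiff.add ?_ ?_)) (contDiff_const.add ?_)
    · exact contDiff_spikeSeries hφ φ.hasCompactSupport hα
    · exact contDiff_spikeSeries hψ φ.hasCompactSupport.mul_left (by simp)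
    · exact contDiff_spikeSeries hφ φ.hasCompactSupport hβ
  · simp [spikeSeries_zero hφ0, spikeSeries_zero hψ0]
  · intro k t ht
    have hu : |8 * (2 ^ k * t - 1)| ≤ 1 := by
      rw [abs_mul]; norm_num; linarith
    have := (hfac k).ne'
    ext
    · simp only [spikeSeries_eq hφ0 _ k ht, spikeSeries_eq hψ0 _ k ht, hφ1 _ hu, α]
      simp
      field_simp
      ring
    · simp only [spikeSeries_eq hφ0 _ k ht, hφ1 _ hu, β]
      simp
      field_simp
      ring

open MeasureTheory FourierTransform

/-! ### Smoothness from bounds on the pure partial derivatives -/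

theorem norm_integral_le_of_indicator_bound {g : ℝ → ℂ} {C R : ℝ} (hR0 : 0 ≤ R)
    (h : ∀ v, ‖g v‖ ≤ (Set.Icc (-R) R).indicator (fun _ => C) v) :
    ‖∫ v, g v‖ ≤ C * (2 * R) := by
  refine (norm_integral_le_of_norm_le ?_ (Eventually.of_forall h)).trans ?_
  · exact (integrable_indicator_iff measurableSet_Icc).2 (by simp [IntegrableOn])
  · rw [integral_indicator measurableSet_Icc]
    simp only [integral_const, MeasurableSet.univ, measureReal_restrict_apply, Set.univ_inter,
      Real.volume_real_Icc, sub_neg_eq_add, smul_eq_mul]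
    rw [max_eq_left (by linarith)]
    linarith

/-- The transform of the `n`-th derivative is `(2πiξ)ⁿ` times that of `φ`. The bound depends only on
`C` and on the radius `R` of the support, so it is uniform over the slices of a function of two
variables. -/
theorem pow_mul_norm_fourier_le {φ : ℝ → ℂ} (hφ : ContDiff ℝ ∞ φ) (hs : HasCompactSupport φ)
    {R C : ℝ} (hR : ∀ x, R < |x| → φ x = 0) (hR0 : 0 ≤ R) (n : ℕ)
    (hC : ∀ x, ‖iteratedDeriv n φ x‖ ≤ C) (ξ : ℝ) :
    |ξ| ^ n * ‖𝓕 φ ξ‖ ≤ C * (2 * R) := by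
  have hint : ∀ m : ℕ, (m : ℕ∞) ≤ ⊤ → Integrable (iteratedDeriv m φ) := fun m _ => by
    refine (hφ.continuous_iteratedDeriv m (by exact_mod_cast le_top)).integrable_of_hasCompactSupport ?_
    rw [iteratedDeriv_eq_equiv_comp]
    exact (hs.iteratedFDeriv (𝕜 := ℝ) m).comp_left (by simp)
  have h1 := congrFun (Real.fourier_iteratedDeriv (N := ⊤) (n := n) hφ hint le_top) ξ
  have h2 : ‖𝓕 (iteratedDeriv n φ) ξ‖ = (2 * Real.pi * |ξ|) ^ n * ‖𝓕 φ ξ‖ := by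
    rw [h1]
    simp [abs_of_pos Real.pi_pos]
  have h3 : ‖𝓕 (iteratedDeriv n φ) ξ‖ ≤ C * (2 * R) := by
    rw [Real.fourier_eq]
    have h0 : ∀ v, ‖Real.fourierChar (-inner ℝ v ξ) • iteratedDeriv n φ v‖ ≤
        (Set.Icc (-R) R).indicator (fun _ => C) v := by
      intro v
      rw [Circle.norm_smul]
      by_cases hv : v ∈ Set.Icc (-R) R
      · rw [Set.indicator_of_mem hv]; exact hC v
      · rw [Set.indicator_of_notMem hv]
        have hv' : R < |v| := by
          by_contra h; exact hv (abs_le.1 (not_lt.1 h))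
        have : φ =ᶠ[𝓝 v] fun _ => 0 :=
          (continuous_abs.continuousAt.eventually (lt_mem_nhds hv')).mono fun x hx => hR x hx
        rw [this.iteratedDeriv_eq]
        simp
    exact norm_integral_le_of_indicator_bound hR0 h0
  calc |ξ| ^ n * ‖𝓕 φ ξ‖ ≤ (2 * Real.pi * |ξ|) ^ n * ‖𝓕 φ ξ‖ := by
        gcongr
        have := Real.pi_gt_three
        nlinarith [abs_nonneg ξ]
    _ ≤ _ := h2 ▸ h3

/-- By Fubini the inner integral is a phase times the transform of a horizontal slice, to which the
one-variable estimate applies; only slices at height `|y| ≤ R` count. -/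
theorem pow_mul_norm_integral_le {f : ℝ × ℝ → ℂ} (hc : Continuous f) (hs : HasCompactSupport f)
    (h1 : ∀ y, ContDiff ℝ ∞ (fun x => f (x, y))) (n : ℕ) {C : ℝ}
    (hC : ∀ x y, ‖iteratedDeriv n (fun x => f (x, y)) x‖ ≤ C) :
    ∃ D, ∀ ξ η : ℝ,
      |ξ| ^ n * ‖∫ z : ℝ × ℝ, Real.fourierChar (-(z.1 * ξ + z.2 * η)) • f z‖ ≤ D := by
  obtain ⟨R, hR0, hR⟩ : ∃ R : ℝ, 0 ≤ R ∧ ∀ z, R < ‖z‖ → f z = 0 := by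
    obtain ⟨R, hR⟩ := hs.isCompact.isBounded.subset_closedBall (0 : ℝ × ℝ)
    refine ⟨max R 0, le_max_right _ _, fun z hz => ?_⟩
    by_contra h
    have := hR (subset_tsupport f h)
    rw [mem_closedBall_zero_iff] at this
    exact absurd (this.trans (le_max_left R 0)) (not_le.2 hz)
  refine ⟨C * (2 * R) * (2 * R), fun ξ η => ?_⟩
  have hch : Continuous fun z : ℝ × ℝ => Real.fourierChar (-(z.1 * ξ + z.2 * η)) :=
    Real.continuous_fourierChar.comp (by fun_prop)
  have hint : Integrable (fun z : ℝ × ℝ => Real.fourierChar (-(z.1 * ξ + z.2 * η)) • f z) := by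
    refine Continuous.integrable_of_hasCompactSupport (hch.smul hc) ?_
    exact hs.smul_left
  have hsy : ∀ y, HasCompactSupport fun x => f (x, y) := fun y =>
    HasCompactSupport.of_support_subset_isCompact (isCompact_Icc (a := -R) (b := R)) fun x hx => by
      by_contra h
      refine hx (hR _ ?_)
      have : R < |x| := by by_contra h'; exact h (abs_le.1 (not_lt.1 h'))
      exact this.trans_le (norm_fst_le (x, y))
  have hin : ∀ y, (∫ x, Real.fourierChar (-(x * ξ + y * η)) • f (x, y)) =
      Real.fourierChar (-(y * η)) • 𝓕 (fun x => f (x, y)) ξ := by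
    intro y
    rw [Real.fourier_eq]
    simp only [Circle.smul_def]
    rw [← integral_smul]
    congr 1; funext x
    rw [smul_smul, ← Circle.coe_mul, ← AddChar.map_add_eq_mul]
    congr 3
    simp only [RCLike.inner_apply, conj_trivial]
    ring
  rw [Measure.volume_eq_prod, integral_prod_symm _ hint]
  simp only [hin]
  rw [← abs_pow, ← Real.norm_eq_abs, ← norm_smul, ← integral_smul]
  have hb : ∀ y, ‖ξ ^ n • (Real.fourierChar (-(y * η)) • 𝓕 (fun x => f (x, y)) ξ)‖ ≤
      (Set.Icc (-R) R).indicator (fun _ => C * (2 * R)) y := by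
    intro y
    rw [norm_smul, Circle.norm_smul, norm_pow, Real.norm_eq_abs]
    by_cases hy : y ∈ Set.Icc (-R) R
    · rw [Set.indicator_of_mem hy]
      exact pow_mul_norm_fourier_le (h1 y) (hsy y)
        (fun x hx => hR _ (hx.trans_le (norm_fst_le (x, y)))) hR0 n (fun x => hC x y) ξ
    · rw [Set.indicator_of_notMem hy]
      have : R < |y| := by by_contra h'; exact hy (abs_le.1 (not_lt.1 h'))
      have h0 : (fun x => f (x, y)) = 0 := by
        funext x; exact hR _ (this.trans_le (norm_snd_le (x, y)))
      rw [h0, Real.fourier_eq]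
      simp
  exact norm_integral_le_of_indicator_bound hR0 hb

/-- No mixed derivative is needed: the two families of pure partials bound `|ξ|ⁿ` and `|η|ⁿ` times
the transform, hence `‖w‖ⁿ` times it. All moments of the transform are then finite, and inversion
exhibits the function as the transform of something with finite moments, which is smooth. -/
theorem contDiff_of_bounded_partials {f : ℝ × ℝ → ℂ} (hc : Continuous f)
    (hs : HasCompactSupport f)
    (h1 : ∀ y, ContDiff ℝ ∞ (fun x => f (x, y))) (h2 : ∀ x, ContDiff ℝ ∞ (fun y => f (x, y)))
    (b1 : ∀ n : ℕ, ∃ C, ∀ x y, ‖iteratedDeriv n (fun x => f (x, y)) x‖ ≤ C)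
    (b2 : ∀ n : ℕ, ∃ C, ∀ x y, ‖iteratedDeriv n (fun y => f (x, y)) y‖ ≤ C) :
    ContDiff ℝ ∞ f := by
  -- The Fourier transform is taken on the Euclidean plane, whereas `ℝ × ℝ` carries the sup norm.
  let g : WithLp 2 (ℝ × ℝ) → ℂ := fun v => f (WithLp.ofLp v)
  have hgc : Continuous g := hc.comp (WithLp.prod_continuous_ofLp 2 ℝ ℝ)
  have hgs : HasCompactSupport g :=
    hs.comp_homeomorph (WithLp.homeomorphProd 2 ℝ ℝ)
  have hF : ∀ w : WithLp 2 (ℝ × ℝ), 𝓕 g w =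
      ∫ z : ℝ × ℝ, Real.fourierChar (-(z.1 * w.fst + z.2 * w.snd)) • f z := by
    intro w
    rw [Real.fourier_eq]
    refine Eq.trans ?_ ((WithLp.volume_preserving_ofLp ℝ ℝ).integral_comp
      (MeasurableEquiv.toLp 2 (ℝ × ℝ)).symm.measurableEmbedding _)
    congr 1; funext v
    simp only [WithLp.prod_inner_apply, RCLike.inner_apply, conj_trivial, g]
    rw [mul_comm w.ofLp.1, mul_comm w.ofLp.2]
    rfl
  have bound : ∀ n : ℕ, ∃ D, ∀ w : WithLp 2 (ℝ × ℝ), ‖w‖ ^ n * ‖𝓕 g w‖ ≤ D := by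
    intro n
    obtain ⟨C1, hC1⟩ := b1 n
    obtain ⟨C2, hC2⟩ := b2 n
    obtain ⟨D1, hD1⟩ := pow_mul_norm_integral_le hc hs h1 n hC1
    obtain ⟨D2, hD2⟩ := pow_mul_norm_integral_le (f := f ∘ Prod.swap) (hc.comp continuous_swap)
      (hs.comp_homeomorph (Homeomorph.prodComm ℝ ℝ)) h2 n (fun x y => hC2 y x)
    refine ⟨2 ^ (n - 1) * (D1 + D2), fun w => ?_⟩
    have e1 := hD1 w.fst w.snd
    have e2 := hD2 w.snd w.fst
    have hsw : (∫ z : ℝ × ℝ, Real.fourierChar (-(z.1 * w.snd + z.2 * w.fst)) • (f ∘ Prod.swap) z) =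
        ∫ z : ℝ × ℝ, Real.fourierChar (-(z.1 * w.fst + z.2 * w.snd)) • f z := by
      rw [Measure.volume_eq_prod, ← integral_prod_swap]
      congr 1; funext z
      simp [add_comm]
    rw [hsw, ← hF] at e2
    rw [← hF] at e1
    have hw : ‖w‖ ≤ |w.fst| + |w.snd| := by
      rw [WithLp.prod_norm_eq_of_L2]
      refine Real.sqrt_le_iff.2 ⟨by positivity, ?_⟩
      simp only [Real.norm_eq_abs]
      nlinarith [abs_nonneg w.fst, abs_nonneg w.snd]
    calc ‖w‖ ^ n * ‖𝓕 g w‖ ≤ (|w.fst| + |w.snd|) ^ n * ‖𝓕 g w‖ := by gcongr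
      _ ≤ (2 ^ (n - 1) * (|w.fst| ^ n + |w.snd| ^ n)) * ‖𝓕 g w‖ := by
          gcongr; exact add_pow_le (abs_nonneg _) (abs_nonneg _) n
      _ = 2 ^ (n - 1) * (|w.fst| ^ n * ‖𝓕 g w‖ + |w.snd| ^ n * ‖𝓕 g w‖) := by ring
      _ ≤ _ := by gcongr
  have hgi : Integrable g := hgc.integrable_of_hasCompactSupport hgs
  have hFc : Continuous (𝓕 g) := by
    have := Real.contDiff_fourier (f := g) (N := 0) (fun n hn => by
      have : n = 0 := by exact_mod_cast nonpos_iff_eq_zero.1 hn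
      subst this; simpa using hgi.norm)
    exact this.continuous
  have hmom : ∀ n : ℕ, Integrable fun w : WithLp 2 (ℝ × ℝ) => ‖w‖ ^ n * ‖𝓕 g w‖ := by
    intro n
    obtain ⟨C₁, h₁⟩ := bound 0
    -- The extra power makes the bound integrable at infinity; the bound of order `0` handles the
    -- neighbourhood of the origin.
    obtain ⟨C₂, h₂⟩ := bound (n + (volume : Measure (WithLp 2 (ℝ × ℝ))).integrablePower)
    exact integrable_of_le_of_pow_mul_le (fun w => by simpa using h₁ w) h₂
      hFc.aestronglyMeasurable
  have hFi : Integrable (𝓕 g) := by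
    have := hmom 0
    simp only [pow_zero, one_mul] at this
    exact (integrable_norm_iff hFc.aestronglyMeasurable).1 this
  have hinv : 𝓕⁻ (𝓕 g) = g := hgc.fourierInv_fourier_eq hgi hFi
  have hsm : ContDiff ℝ ∞ g := by
    have h3 : ContDiff ℝ ∞ (𝓕 (𝓕 g)) := Real.contDiff_fourier (N := ⊤) fun n _ => hmom n
    have h4 : g = fun v => 𝓕 (𝓕 g) (-v) := by
      rw [← hinv]; funext v
      rw [Real.fourierInv_eq_fourier_neg, hinv]
    rw [h4]
    exact h3.comp contDiff_neg
  have : f = fun z => g ((WithLp.prodContinuousLinearEquiv 2 ℝ ℝ ℝ).symm z) := rfl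
  rw [this]
  exact hsm.comp (ContinuousLinearEquiv.contDiff _)

/-! ### Boman's theorem in the plane -/

/-- `f` maps smooth curves to smooth curves. -/
def CurveSmooth (f : ℝ × ℝ → ℝ) : Prop :=
  ∀ c : ℝ → ℝ × ℝ, ContDiff ℝ ∞ c → ContDiff ℝ ∞ fun t => f (c t)

/-- If `A` were not a neighbourhood of `q ∈ A`, there would be points outside `A` within `1 / k!` of
`q`. A smooth curve passing through them at the times `2⁻ᵏ` and through `q` at time `0` has a
preimage of `A` that contains `0` but no `2⁻ᵏ`. -/
theorem isOpen_of_curve {A : Set (ℝ × ℝ)}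
    (h : ∀ c : ℝ → ℝ × ℝ, ContDiff ℝ ∞ c → IsOpen (c ⁻¹' A)) : IsOpen A := by
  rw [isOpen_iff_mem_nhds]
  intro q hq
  by_contra hA
  have hp : ∀ k : ℕ, ∃ p, ‖p - q‖ ≤ 1 / (k.factorial : ℝ) ∧ p ∉ A := by
    intro k
    by_contra hk
    push Not at hk
    refine hA (mem_of_superset (Metric.closedBall_mem_nhds q (ε := 1 / (k.factorial : ℝ)) ?_) ?_)
    · have : (0 : ℝ) < k.factorial := by exact_mod_cast k.factorial_pos
      positivity
    · intro p hp
      exact hk p (by rwa [mem_closedBall_iff_norm] at hp)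
  choose p hp hpA using hp
  obtain ⟨c, hc, hc0, hck⟩ := exists_curve_through hp
  have h0 : c ⁻¹' A ∈ 𝓝 (0 : ℝ) := (h c hc).mem_nhds (by simpa [hc0] using hq)
  have ht : Tendsto (fun k : ℕ => (1 / 2 : ℝ) ^ k) atTop (𝓝 0) :=
    tendsto_pow_atTop_nhds_zero_of_lt_one (by norm_num) (by norm_num)
  obtain ⟨k, hk⟩ := (ht.eventually h0).exists
  have h2 : (2 : ℝ) ^ k * (1 / 2) ^ k = 1 := by rw [← mul_pow]; norm_num
  have := hck k ((1 / 2) ^ k) (by rw [h2]; norm_num)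
  rw [h2] at this
  have hk' : c ((1 / 2) ^ k) ∈ A := hk
  rw [this] at hk'
  rw [sub_self, mul_zero, zero_div, Prod.mk_zero_zero, add_zero] at hk'
  exact hpA k hk'

theorem CurveSmooth.continuous {f : ℝ × ℝ → ℝ} (hf : CurveSmooth f) : Continuous f :=
  ⟨fun s hs => isOpen_of_curve fun c hc => (hf c hc).continuous.isOpen_preimage s hs⟩

theorem CurveSmooth.contDiff_left {f : ℝ × ℝ → ℝ} (hf : CurveSmooth f) (y : ℝ) :
    ContDiff ℝ ∞ fun x => f (x, y) :=
  hf (fun x => (x, y)) (by fun_prop)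

/-- Otherwise choose points converging fast to `q` at which the derivative is huge. The special
curve crosses the `k`-th one horizontally with constant speed, so the `n`-th derivative of `f ∘ c`
at `2⁻ᵏ` is that of the slice times the `n`-th power of the speed. It would be unbounded near `0`,
against continuity. -/
theorem CurveSmooth.locally_bounded {f : ℝ × ℝ → ℝ} (hf : CurveSmooth f) (n : ℕ) (q : ℝ × ℝ) :
    ∃ C, ∀ᶠ p in 𝓝 q, |iteratedDeriv n (fun x => f (x, p.2)) p.1| ≤ C := by
  by_contra hcon
  push Not at hcon
  have hfac : ∀ k : ℕ, (0 : ℝ) < k.factorial := fun k => by exact_mod_cast k.factorial_pos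
  -- The speed at the `k`-th point is `8 * 2 ^ k / k!`; the threshold carries the inverse of its
  -- `n`-th power, so that the derivative along the curve exceeds `k`.
  have hp : ∀ k : ℕ, ∃ p, ‖p - q‖ ≤ 1 / (k.factorial : ℝ) ∧
      k * ((k.factorial : ℝ) / (8 * 2 ^ k)) ^ n <
        |iteratedDeriv n (fun x => f (x, p.2)) p.1| := by
    intro k
    have h1 := (hcon (k * ((k.factorial : ℝ) / (8 * 2 ^ k)) ^ n)).and_eventually
      (Metric.closedBall_mem_nhds q (ε := 1 / (k.factorial : ℝ)) (by have := hfac k; positivity))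
    obtain ⟨p, hp1, hp2⟩ := h1.exists
    exact ⟨p, by rwa [← dist_eq_norm], hp1⟩
  choose p hp hpk using hp
  obtain ⟨c, hc, hc0, hck⟩ := exists_curve_through hp
  have hcont : Continuous (iteratedDeriv n fun t => f (c t)) :=
    (hf c hc).continuous_iteratedDeriv n (by exact_mod_cast le_top)
  have ht : Tendsto (fun k : ℕ => (1 / 2 : ℝ) ^ k) atTop (𝓝 0) :=
    tendsto_pow_atTop_nhds_zero_of_lt_one (by norm_num) (by norm_num)
  have hlim := ((hcont.tendsto 0).comp ht).abs
  have hval : ∀ k : ℕ, (k : ℝ) < |iteratedDeriv n (fun t => f (c t)) ((1 / 2) ^ k)| := by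
    intro k
    have h2 : (2 : ℝ) ^ k * (1 / 2) ^ k = 1 := by rw [← mul_pow]; norm_num
    have hev : (fun t => f (c t)) =ᶠ[𝓝 ((1 / 2 : ℝ) ^ k)] fun t =>
        1 * f (8 * 2 ^ k / (k.factorial : ℝ) * t + ((p k).1 - 8 / (k.factorial : ℝ)), (p k).2) := by
      have : ∀ᶠ t in 𝓝 ((1 / 2 : ℝ) ^ k), |2 ^ k * t - 1| < 1 / 8 := by
        have hcn : Continuous fun t : ℝ => |(2 : ℝ) ^ k * t - 1| := by fun_prop
        exact hcn.continuousAt.eventually_lt continuousAt_const (by rw [h2]; norm_num)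
      filter_upwards [this] with t ht
      rw [hck k t ht, one_mul]
      congr 1
      have := (hfac k).ne'
      ext
      · simp only [Prod.fst_add]; field_simp; ring
      · simp
    rw [hev.iteratedDeriv_eq, iteratedDeriv_spike (hf.contDiff_left (p k).2), one_mul]
    have hx : 8 * 2 ^ k / (k.factorial : ℝ) * (1 / 2) ^ k + ((p k).1 - 8 / (k.factorial : ℝ)) =
        (p k).1 := by
      have : 8 * 2 ^ k / (k.factorial : ℝ) * (1 / 2) ^ k =
        8 / (k.factorial : ℝ) * (2 ^ k * (1 / 2) ^ k) := by ring
      rw [this, h2]; ring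
    rw [hx, abs_mul, abs_of_pos (by have := hfac k; positivity)]
    have hpos : 0 < (8 * 2 ^ k / (k.factorial : ℝ)) ^ n := by have := hfac k; positivity
    have h3 := mul_lt_mul_of_pos_left (hpk k) hpos
    have h4 : (8 * 2 ^ k / (k.factorial : ℝ)) ^ n * (k * ((k.factorial : ℝ) / (8 * 2 ^ k)) ^ n) =
        k := by
      have h5 : (8 * 2 ^ k / (k.factorial : ℝ)) * ((k.factorial : ℝ) / (8 * 2 ^ k)) = 1 := by
        have := (hfac k).ne'
        field_simp
      rw [mul_left_comm, ← mul_pow, h5, one_pow, mul_one]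
    rwa [h4] at h3
  have hbd : ∀ᶠ k : ℕ in atTop, |iteratedDeriv n (fun t => f (c t)) ((1 / 2) ^ k)| <
      |iteratedDeriv n (fun t => f (c t)) 0| + 1 :=
    hlim.eventually_lt_const (lt_add_one _)
  obtain ⟨k, hk1, hk2⟩ := (hbd.and
    (eventually_ge_atTop ⌈|iteratedDeriv n (fun t => f (c t)) 0| + 1⌉₊)).exists
  have := hval k
  have := Nat.ceil_le.1 hk2
  linarith

theorem CurveSmooth.bounded_iteratedDeriv {f : ℝ × ℝ → ℝ} (hf : CurveSmooth f)
    (hs : HasCompactSupport f) (n : ℕ) :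
    ∃ C, ∀ x y, |iteratedDeriv n (fun x => f (x, y)) x| ≤ C := by
  have hK : ∃ C, ∀ p ∈ tsupport f, |iteratedDeriv n (fun x => f (x, p.2)) p.1| ≤ C := by
    refine hs.isCompact.induction_on (p := fun K => ∃ C, ∀ p ∈ K,
      |iteratedDeriv n (fun x => f (x, p.2)) p.1| ≤ C) ⟨0, by simp⟩ ?_ ?_ ?_
    · rintro s t hst ⟨C, hC⟩
      exact ⟨C, fun p hp => hC p (hst hp)⟩
    · rintro s t ⟨C, hC⟩ ⟨D, hD⟩
      refine ⟨max C D, fun p hp => ?_⟩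
      rcases hp with hp | hp
      · exact (hC p hp).trans (le_max_left _ _)
      · exact (hD p hp).trans (le_max_right _ _)
    · intro q _
      obtain ⟨C, hC⟩ := hf.locally_bounded n q
      exact ⟨_, mem_nhdsWithin_of_mem_nhds hC, C, fun p hp => hp⟩
  obtain ⟨C, hC⟩ := hK
  refine ⟨max C 0, fun x y => ?_⟩
  by_cases hxy : (x, y) ∈ tsupport f
  · exact (hC _ hxy).trans (le_max_left _ _)
  · have h1 : f =ᶠ[𝓝 (x, y)] 0 := notMem_tsupport_iff_eventuallyEq.1 hxy
    have h2 : (fun x => f (x, y)) =ᶠ[𝓝 x] fun _ => 0 :=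
      (Continuous.prodMk_left y).continuousAt.eventually h1
    rw [h2.iteratedDeriv_eq]
    simp

theorem norm_iteratedDeriv_ofReal {φ : ℝ → ℝ} (hφ : ContDiff ℝ ∞ φ) (n : ℕ) (x : ℝ) :
    ‖iteratedDeriv n (fun x => (φ x : ℂ)) x‖ = |iteratedDeriv n φ x| := by
  rw [← norm_iteratedFDeriv_eq_norm_iteratedDeriv, ← Real.norm_eq_abs,
    ← norm_iteratedFDeriv_eq_norm_iteratedDeriv]
  exact Complex.ofRealLI.norm_iteratedFDeriv_comp_left (hφ.contDiffAt (x := x))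
    (i := n) (by exact_mod_cast le_top)

theorem CurveSmooth.contDiff_of_hasCompactSupport {f : ℝ × ℝ → ℝ} (hf : CurveSmooth f)
    (hs : HasCompactSupport f) : ContDiff ℝ ∞ f := by
  have hf' : CurveSmooth (f ∘ Prod.swap) := fun c hc =>
    hf (fun t => (c t).swap) (hc.snd.prodMk hc.fst)
  have hs' : HasCompactSupport (f ∘ Prod.swap) := hs.comp_homeomorph (Homeomorph.prodComm ℝ ℝ)
  have key : ContDiff ℝ ∞ (fun z => (f z : ℂ)) := by
    refine contDiff_of_bounded_partials (Complex.continuous_ofReal.comp hf.continuous)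
      (hs.comp_left Complex.ofReal_zero)
      (fun y => Complex.ofRealCLM.contDiff.comp (hf.contDiff_left y))
      (fun x => Complex.ofRealCLM.contDiff.comp (hf'.contDiff_left x)) (fun n => ?_) (fun n => ?_)
    · obtain ⟨C, hC⟩ := hf.bounded_iteratedDeriv hs n
      exact ⟨C, fun x y => (norm_iteratedDeriv_ofReal (hf.contDiff_left y) n x).trans_le (hC x y)⟩
    · obtain ⟨C, hC⟩ := hf'.bounded_iteratedDeriv hs' n
      exact ⟨C, fun x y => (norm_iteratedDeriv_ofReal (hf'.contDiff_left x) n y).trans_le (hC y x)⟩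
  exact Complex.reCLM.contDiff.comp key

/-- The map `q ↦ p + χ(q) (q - p)` is the identity near `p` and sends everything into a small ball.
Composing with it turns local statements into global ones: a curve is forced into `A` without
changing its germ at `p`. -/
theorem exists_retraction {V : Type*} [NormedAddCommGroup V] [NormedSpace ℝ V]
    [FiniteDimensional ℝ V] {A : Set V} {p : V} (hA : A ∈ 𝓝 p) :
    ∃ κ : V → V, ContDiff ℝ ∞ κ ∧ (∀ᶠ q in 𝓝 p, κ q = q) ∧ ∀ q, κ q ∈ A := by
  obtain ⟨δ, hδ, hδA⟩ := Metric.mem_nhds_iff.1 hA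
  let χ : ContDiffBump p := ⟨δ / 2, δ, by positivity, by linarith⟩
  refine ⟨fun q => p + χ q • (q - p), ?_, ?_, fun q => hδA ?_⟩
  · exact contDiff_const.add (χ.contDiff.smul (contDiff_id.sub contDiff_const))
  · filter_upwards [χ.eventuallyEq_one] with q hq
    simp [hq]
  · rw [mem_ball_iff_norm, add_sub_cancel_left, norm_smul, Real.norm_of_nonneg χ.nonneg]
    by_cases hq : q ∈ Metric.ball p δ
    · rw [mem_ball_iff_norm] at hq
      exact (mul_le_of_le_one_left (norm_nonneg _) χ.le_one).trans_lt hq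
    · rw [χ.zero_of_le_dist (by simpa using hq), zero_mul]
      exact hδ

/-- Boman's theorem: a function on an open subset of the plane is smooth if it is smooth along
smooth curves. -/
theorem contDiffAt_of_curve {h : ℝ × ℝ → ℝ} {A : Set (ℝ × ℝ)}
    (hh : ∀ c : ℝ → ℝ × ℝ, ContDiff ℝ ∞ c → (∀ t, c t ∈ A) → ContDiff ℝ ∞ fun t => h (c t))
    {p : ℝ × ℝ} (hA : A ∈ 𝓝 p) : ContDiffAt ℝ ∞ h p := by
  obtain ⟨κ, hκ, hκp, hκA⟩ := exists_retraction hA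
  let χ : ContDiffBump p := ⟨1, 2, one_pos, by norm_num⟩
  -- Composition with `κ` keeps all test curves in `A`, and the factor `χ` gives compact support;
  -- neither changes `h` near `p`.
  have hf : CurveSmooth fun q => χ q * h (κ q) := fun c hc =>
    (χ.contDiff.comp hc).mul (hh _ (hκ.comp hc) fun t => hκA _)
  have hfs := hf.contDiff_of_hasCompactSupport χ.hasCompactSupport.mul_right
  refine hfs.contDiffAt.congr_of_eventuallyEq ?_
  filter_upwards [hκp, χ.eventuallyEq_one] with q h1 h2
  simp [h1, h2]

/-! ### Two facts of one and two variable calculus -/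

/-- Differentiation under the integral brings out one factor `r`. With the weight `r ^ k` built in,
the family of such averages is closed under differentiation, which drives the induction for
smoothness. -/
theorem hasDerivAt_average {φ : ℝ → ℝ} (hφ : ContDiff ℝ ∞ φ) (k : ℕ) (s : ℝ) :
    HasDerivAt (fun s => ∫ r in (0 : ℝ)..1, r ^ k * φ (s * r))
      (∫ r in (0 : ℝ)..1, r ^ (k + 1) * deriv φ (s * r)) s := by
  have hd : Continuous (deriv φ) := hφ.continuous_deriv (by simp)
  have hc := hφ.continuous
  obtain ⟨C, hC⟩ := (isCompact_Icc (a := -(|s| + 1)) (b := |s| + 1)).exists_bound_of_continuousOn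
    hd.continuousOn
  refine (intervalIntegral.hasDerivAt_integral_of_dominated_loc_of_deriv_le
    (F' := fun s r => r ^ (k + 1) * deriv φ (s * r)) (bound := fun _ => C)
    (Metric.ball_mem_nhds s one_pos) ?_ ?_ ?_ ?_ ?_ ?_).2
  · exact Eventually.of_forall fun s => (by fun_prop : Continuous _).aestronglyMeasurable
  · exact (by fun_prop : Continuous _).intervalIntegrable _ _
  · exact (by fun_prop : Continuous _).aestronglyMeasurable
  · refine Eventually.of_forall fun r hr x hx => ?_
    rw [Set.uIoc_of_le zero_le_one] at hr
    rw [Real.norm_eq_abs, abs_mul, abs_of_nonneg (pow_nonneg hr.1.le _)]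
    have h1 : |x| ≤ |s| + 1 := by
      have h2 := abs_sub_abs_le_abs_sub x s
      have h3 : |x - s| < 1 := by simpa [Real.dist_eq] using hx
      linarith
    have h4 : |x * r| ≤ |s| + 1 := by
      rw [abs_mul, abs_of_pos hr.1]
      nlinarith [abs_nonneg x, hr.2, hr.1]
    have h5 := hC (x * r) (abs_le.1 h4)
    rw [Real.norm_eq_abs] at h5
    have h6 : r ^ (k + 1) ≤ 1 := pow_le_one₀ hr.1.le hr.2
    nlinarith [abs_nonneg (deriv φ (x * r)), pow_nonneg hr.1.le (k + 1)]
  · exact intervalIntegrable_const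
  · refine Eventually.of_forall fun r _ x _ => ?_
    have h1 : HasDerivAt φ (deriv φ (x * r)) (x * r) :=
      (hφ.differentiable (by simp) _).hasDerivAt
    have h2 := (h1.comp x ((hasDerivAt_id x).mul_const r)).const_mul (r ^ k)
    convert! h2 using 1
    ring

theorem contDiff_average {φ : ℝ → ℝ} (hφ : ContDiff ℝ ∞ φ) (k : ℕ) :
    ContDiff ℝ ∞ fun s => ∫ r in (0 : ℝ)..1, r ^ k * φ (s * r) := by
  rw [contDiff_infty]
  intro n
  induction n generalizing φ k with
  | zero =>
    refine contDiff_zero.2 (continuous_iff_continuousAt.2 fun s => ?_)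
    exact (hasDerivAt_average hφ k s).continuousAt
  | succ n ih =>
    refine (contDiff_succ_iff_deriv (n := n)).2
      ⟨fun s => (hasDerivAt_average hφ k s).differentiableAt, by simp, ?_⟩
    have : (deriv fun s => ∫ r in (0 : ℝ)..1, r ^ k * φ (s * r)) =
        fun s => ∫ r in (0 : ℝ)..1, r ^ (k + 1) * deriv φ (s * r) :=
      funext fun s => (hasDerivAt_average hφ k s).deriv
    rw [this]
    exact ih (contDiff_infty_iff_deriv.1 hφ).2 (k + 1)

/-- Hadamard's lemma in one variable. -/
theorem contDiff_dslope {f : ℝ → ℝ} (hf : ContDiff ℝ ∞ f) : ContDiff ℝ ∞ (dslope f 0) := by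
  have hd := (contDiff_infty_iff_deriv.1 hf).2
  -- `f(s) - f(0) = s ∫₀¹ f'(sr) dr`, so the slope at `0` is an average of `f'`, including its value
  -- at `s = 0`.
  convert contDiff_average hd 0 using 1
  funext s
  simp only [pow_zero, one_mul]
  rcases eq_or_ne s 0 with rfl | hs
  · simp
  · rw [dslope_of_ne _ hs, slope_def_field, intervalIntegral.integral_comp_mul_left _ hs,
      intervalIntegral.integral_deriv_eq_sub (fun x _ => hf.differentiable (by simp) x)
        (hd.continuous.intervalIntegrable _ _)]
    simp
    field_simp

theorem hasDerivAt_partial_snd {K : ℝ × ℝ → ℝ} {a b : ℝ} (h : DifferentiableAt ℝ K (a, b)) :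
    HasDerivAt (fun b => K (a, b)) (fderiv ℝ K (a, b) (0, 1)) b :=
  h.hasFDerivAt.comp_hasDerivAt b ((hasDerivAt_const b a).prodMk (hasDerivAt_id b))

theorem hasDerivAt_partial_fst {K : ℝ × ℝ → ℝ} {a b : ℝ} (h : DifferentiableAt ℝ K (a, b)) :
    HasDerivAt (fun a => K (a, b)) (fderiv ℝ K (a, b) (1, 0)) a :=
  h.hasFDerivAt.comp_hasDerivAt a ((hasDerivAt_id a).prodMk (hasDerivAt_const a b))

theorem deriv_deriv_comm {K : ℝ × ℝ → ℝ} (h : ContDiffAt ℝ ∞ K 0) :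
    deriv (fun a => deriv (fun b => K (a, b)) 0) 0 =
      deriv (fun b => deriv (fun a => K (a, b)) 0) 0 := by
  have hd : ∀ᶠ p in 𝓝 (0 : ℝ × ℝ), DifferentiableAt ℝ K p := by
    have := (h.of_le (m := 1) (by exact_mod_cast le_top)).eventually (by simp)
    exact this.mono fun p hp => hp.differentiableAt (by simp)
  have hD : DifferentiableAt ℝ (fderiv ℝ K) 0 :=
    (h.fderiv_right (m := ∞) (by simp)).differentiableAt (by simp)
  have c1 : Tendsto (fun a : ℝ => (a, (0 : ℝ))) (𝓝 0) (𝓝 0) := by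
    have : Continuous fun a : ℝ => (a, (0 : ℝ)) := by fun_prop
    exact this.tendsto' _ _ rfl
  have c2 : Tendsto (fun b : ℝ => ((0 : ℝ), b)) (𝓝 0) (𝓝 0) := by
    have : Continuous fun b : ℝ => ((0 : ℝ), b) := by fun_prop
    exact this.tendsto' _ _ rfl
  have e1 : (fun a => deriv (fun b => K (a, b)) 0) =ᶠ[𝓝 0] fun a => fderiv ℝ K (a, 0) (0, 1) :=
    (c1.eventually hd).mono fun a ha => (hasDerivAt_partial_snd ha).deriv
  have e2 : (fun b => deriv (fun a => K (a, b)) 0) =ᶠ[𝓝 0] fun b => fderiv ℝ K (0, b) (1, 0) :=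
    (c2.eventually hd).mono fun b hb => (hasDerivAt_partial_fst hb).deriv
  have hD' : HasFDerivAt (fderiv ℝ K) (fderiv ℝ (fderiv ℝ K) 0) ((0 : ℝ), (0 : ℝ)) := hD.hasFDerivAt
  have d1 := (hD'.comp_hasDerivAt (f := fun a => (a, 0)) (0 : ℝ)
    ((hasDerivAt_id (0 : ℝ)).prodMk (hasDerivAt_const (0 : ℝ) (0 : ℝ)))).clm_apply
      (hasDerivAt_const (0 : ℝ) ((0 : ℝ), (1 : ℝ)))
  have d2 := (hD'.comp_hasDerivAt (f := fun b => (0, b)) (0 : ℝ)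
    ((hasDerivAt_const (0 : ℝ) (0 : ℝ)).prodMk (hasDerivAt_id (0 : ℝ)))).clm_apply
      (hasDerivAt_const (0 : ℝ) ((1 : ℝ), (0 : ℝ)))
  rw [e1.deriv_eq, e2.deriv_eq]
  refine d1.deriv.trans (Eq.trans ?_ d2.deriv.symm)
  have hsym := h.isSymmSndFDerivAt (by
    rw [minSmoothness_of_isRCLikeNormedField]
    exact WithTop.coe_le_coe.2 (le_top : (2 : ℕ∞) ≤ ⊤)) (1, 0) (0, 1)
  simpa using hsym

/-! ### Smooth curves -/

section Curves

variable {E : Type*} [AddCommGroup E] [Module ℝ E] [TopologicalSpace E]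

theorem hasCurveDerivAt_real {c : ℝ → ℝ} {v t : ℝ} :
    HasCurveDerivAt c v t ↔ HasDerivAt c v t :=
  hasDerivAt_iff_tendsto_slope_zero.symm

theorem HasCurveDerivAt.clm {c : ℝ → E} {v : E} {t : ℝ} (h : HasCurveDerivAt c v t)
    (l : E →L[ℝ] ℝ) : HasDerivAt (fun s => l (c s)) (l v) t := by
  refine hasCurveDerivAt_real.1 ?_
  have := (l.continuous.tendsto v).comp h
  refine this.congr fun s => ?_
  simp

theorem HasCurveDerivAt.congr {c c' : ℝ → E} {v : E} {t : ℝ} (h : HasCurveDerivAt c v t)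
    (hc : c' =ᶠ[𝓝 t] c) : HasCurveDerivAt c' v t := by
  refine Tendsto.congr' ?_ h
  have h1 : Tendsto (fun s : ℝ => t + s) (𝓝[≠] 0) (𝓝 t) := by
    have : Continuous fun s : ℝ => t + s := by fun_prop
    exact (this.tendsto' 0 t (by simp)).mono_left nhdsWithin_le_nhds
  filter_upwards [h1.eventually hc] with s hs
  rw [hs, hc.eq_of_nhds]

theorem SmoothCurve.contDiff {c : ℝ → E} (hc : SmoothCurve c) (l : E →L[ℝ] ℝ) :
    ContDiff ℝ ∞ fun t => l (c t) := by
  obtain ⟨d, rfl, hd⟩ := hc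
  rw [contDiff_infty]
  intro n
  suffices ∀ k, ContDiff ℝ n fun t => l (d k t) from this 0
  induction n with
  | zero =>
    intro k
    refine contDiff_zero.2 (continuous_iff_continuousAt.2 fun t => ?_)
    exact ((hd k t).clm l).continuousAt
  | succ n ih =>
    intro k
    refine (contDiff_succ_iff_deriv (n := n)).2
      ⟨fun t => ((hd k t).clm l).differentiableAt, by simp, ?_⟩
    have : (deriv fun t => l (d k t)) = fun t => l (d (k + 1) t) :=
      funext fun t => ((hd k t).clm l).deriv
    rw [this]
    exact ih (k + 1)

theorem smoothCurve_real {c : ℝ → ℝ} : SmoothCurve c ↔ ContDiff ℝ ∞ c := by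
  refine ⟨fun h => h.contDiff (ContinuousLinearMap.id ℝ ℝ), fun h => ?_⟩
  refine ⟨fun n => iteratedDeriv n c, iteratedDeriv_zero, fun n t => hasCurveDerivAt_real.2 ?_⟩
  change HasDerivAt (iteratedDeriv n c) (iteratedDeriv (n + 1) c t) t
  rw [iteratedDeriv_succ]
  exact (h.differentiable_iteratedDeriv n (by exact_mod_cast ENat.natCast_lt_top n) t).hasDerivAt

instance instConvenientSpaceReal : ConvenientSpace ℝ where
  smooth_of_scalarwise := fun _ h => smoothCurve_real.2 (h (ContinuousLinearMap.id ℝ ℝ))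

theorem SmoothCurve.exists_deriv {c : ℝ → E} (hc : SmoothCurve c) :
    ∃ c' : ℝ → E, SmoothCurve c' ∧ ∀ t, HasCurveDerivAt c (c' t) t := by
  obtain ⟨d, rfl, hd⟩ := hc
  exact ⟨d 1, ⟨fun n => d (n + 1), rfl, fun n t => hd (n + 1) t⟩, hd 0⟩

variable [ConvenientSpace E]

/-- Here `c^∞`-completeness enters: the closure properties of smooth curves below reduce to those of
real functions. -/
theorem smoothCurve_iff {c : ℝ → E} :
    SmoothCurve c ↔ ∀ l : E →L[ℝ] ℝ, ContDiff ℝ ∞ fun t => l (c t) :=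
  ⟨SmoothCurve.contDiff, ConvenientSpace.smooth_of_scalarwise c⟩

theorem eq_of_forall_clm {x y : E} (h : ∀ l : E →L[ℝ] ℝ, l x = l y) : x = y :=
  (SeparatingDual.eq_iff_forall_dual_eq (R := ℝ)).2 h

theorem smoothCurve_const (x : E) : SmoothCurve fun _ : ℝ => x :=
  smoothCurve_iff.2 fun _ => contDiff_const

theorem SmoothCurve.add {c d : ℝ → E} (hc : SmoothCurve c) (hd : SmoothCurve d) :
    SmoothCurve fun t => c t + d t :=
  smoothCurve_iff.2 fun l => by simpa using (hc.contDiff l).add (hd.contDiff l)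

theorem SmoothCurve.sub {c d : ℝ → E} (hc : SmoothCurve c) (hd : SmoothCurve d) :
    SmoothCurve fun t => c t - d t :=
  smoothCurve_iff.2 fun l => by simpa using (hc.contDiff l).sub (hd.contDiff l)

theorem SmoothCurve.smul {f : ℝ → ℝ} {c : ℝ → E} (hf : ContDiff ℝ ∞ f) (hc : SmoothCurve c) :
    SmoothCurve fun t => f t • c t :=
  smoothCurve_iff.2 fun l => by simpa using hf.mul (hc.contDiff l)

theorem SmoothCurve.comp {c : ℝ → E} {f : ℝ → ℝ} (hc : SmoothCurve c) (hf : ContDiff ℝ ∞ f) :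
    SmoothCurve fun t => c (f t) :=
  smoothCurve_iff.2 fun l => (hc.contDiff l).comp hf

theorem SmoothCurve.sum {ι : Type*} {s : Finset ι} {c : ι → ℝ → E}
    (hc : ∀ i ∈ s, SmoothCurve (c i)) : SmoothCurve fun t => ∑ i ∈ s, c i t :=
  smoothCurve_iff.2 fun l => by
    simpa using ContDiff.sum fun i hi => (hc i hi).contDiff l

theorem smoothCurve_of_locally {c : ℝ → E}
    (h : ∀ t, ∃ c' : ℝ → E, SmoothCurve c' ∧ c =ᶠ[𝓝 t] c') : SmoothCurve c :=
  smoothCurve_iff.2 fun l => contDiff_iff_contDiffAt.2 fun t => by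
    obtain ⟨c', hc', he⟩ := h t
    exact (hc'.contDiff l).contDiffAt.congr_of_eventuallyEq (he.fun_comp l)

/-- A smooth curve is `γ(0) + s w(s)` with `w` smooth. -/
theorem SmoothCurve.exists_quotient {γ : ℝ → E} (hγ : SmoothCurve γ) {v : E}
    (hv : HasCurveDerivAt γ v 0) :
    ∃ w : ℝ → E, SmoothCurve w ∧ w 0 = v ∧ ∀ s, γ s = γ 0 + s • w s := by
  classical
  refine ⟨fun s => if s = 0 then v else s⁻¹ • (γ s - γ 0), ?_, by simp, fun s => ?_⟩
  · refine smoothCurve_iff.2 fun l => ?_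
    -- Tested with `l`, the quotient is the slope function of `l ∘ γ`, smooth by Hadamard's lemma.
    convert contDiff_dslope (hγ.contDiff l) using 1
    funext s
    rcases eq_or_ne s 0 with rfl | hs
    · simp [(hv.clm l).deriv]
    · rw [dslope_of_ne _ hs, if_neg hs, slope_def_field]
      simp
      field_simp
  · rcases eq_or_ne s 0 with rfl | hs
    · simp
    · simp [hs, smul_smul]

end Curves

/-! ### Smooth maps on `c^∞`-open sets -/

section Maps

set_option linter.unusedSectionVars false

variable {E : Type*} [AddCommGroup E] [Module ℝ E] [TopologicalSpace E]
variable {F : Type*} [AddCommGroup F] [Module ℝ F] [TopologicalSpace F]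

/-- The set `W` is open for the `c^∞`-topology. -/
def CurveOpen (W : Set E) : Prop :=
  ∀ c : ℝ → E, SmoothCurve c → IsOpen (c ⁻¹' W)

theorem SmoothOn.mono {f : E → F} {s t : Set E} (h : SmoothOn f t) (hst : s ⊆ t) : SmoothOn f s :=
  fun c hc hs => h c hc fun r => hst (hs r)

theorem SmoothOn.congr {f g : E → F} {s : Set E} (h : SmoothOn f s) (hg : ∀ x ∈ s, g x = f x) :
    SmoothOn g s := fun c hc hs => by
  simpa only [hg _ (hs _)] using h c hc hs

variable [ConvenientSpace E] [ConvenientSpace F]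

theorem SmoothOn.clm {f : E → F} {s : Set E} (h : SmoothOn f s) (l : F →L[ℝ] ℝ) :
    SmoothOn (fun x => l (f x)) s :=
  fun c hc hs => smoothCurve_real.2 ((h c hc hs).contDiff l)

theorem smoothCurve_line (x v : E) : SmoothCurve fun s : ℝ => x + s • v :=
  (smoothCurve_const x).add (SmoothCurve.smul contDiff_id (smoothCurve_const v))

theorem hasCurveDerivAt_line (x v : E) : HasCurveDerivAt (fun s : ℝ => x + s • v) v 0 := by
  refine Tendsto.congr' ?_ tendsto_const_nhds
  filter_upwards [self_mem_nhdsWithin] with s hs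
  have hs' : s ≠ 0 := hs
  simp [smul_smul, hs']

theorem CurveOpen.eventually_curve {W : Set E} (hW : CurveOpen W) {c : ℝ → E} (hc : SmoothCurve c)
    {t : ℝ} (ht : c t ∈ W) : ∀ᶠ s in 𝓝 t, c s ∈ W :=
  (hW c hc).mem_nhds ht

theorem CurveOpen.eventually_line {W : Set E} (hW : CurveOpen W) {x : E} (hx : x ∈ W) (v : E) :
    ∀ᶠ s in 𝓝 (0 : ℝ), x + s • v ∈ W :=
  hW.eventually_curve (smoothCurve_line x v) (by simpa using hx)

/-- A smooth curve can be replaced by one that stays in a given `c^∞`-open set. -/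
theorem CurveOpen.exists_curve {W : Set E} (hW : CurveOpen W) {c : ℝ → E} (hc : SmoothCurve c)
    {t : ℝ} (ht : c t ∈ W) :
    ∃ c' : ℝ → E, SmoothCurve c' ∧ c' =ᶠ[𝓝 t] c ∧ ∀ s, c' s ∈ W := by
  obtain ⟨κ, hκ, hκt, hκW⟩ := exists_retraction (hW.eventually_curve hc ht)
  exact ⟨fun s => c (κ s), hc.comp hκ, hκt.mono fun s hs => by simp only [hs], hκW⟩

theorem dirDeriv_eq {f : E → F} {x v : E} {d : F}
    (h : HasCurveDerivAt (fun s : ℝ => f (x + s • v)) d 0) : dirDeriv f x v = d := by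
  refine Tendsto.limUnder_eq ?_
  simpa [HasCurveDerivAt] using h

/-- On a `c^∞`-open set the limit defining `dirDeriv` exists, so the default value of `limUnder`
plays no role: the line through `x` agrees near `x` with a smooth curve that stays in `W`. -/
theorem SmoothOn.hasCurveDerivAt {f : E → F} {W : Set E} (hf : SmoothOn f W) (hW : CurveOpen W)
    {x : E} (hx : x ∈ W) (v : E) :
    HasCurveDerivAt (fun s : ℝ => f (x + s • v)) (dirDeriv f x v) 0 := by
  obtain ⟨c, hc, hcx, hcW⟩ := hW.exists_curve (smoothCurve_line x v) (t := 0) (by simpa using hx)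
  obtain ⟨c', -, hc'⟩ := (hf c hc hcW).exists_deriv
  have h : HasCurveDerivAt (fun s : ℝ => f (x + s • v)) (c' 0) 0 :=
    (hc' 0).congr (hcx.symm.fun_comp f)
  rwa [dirDeriv_eq h]

theorem SmoothOn.hasDerivAt {G : E → ℝ} {W : Set E} (hG : SmoothOn G W) (hW : CurveOpen W)
    {x : E} (hx : x ∈ W) (v : E) : HasDerivAt (fun s : ℝ => G (x + s • v)) (dirDeriv G x v) 0 :=
  hasCurveDerivAt_real.1 (hG.hasCurveDerivAt hW hx v)

theorem dirDeriv_eq_of_hasDerivAt {G : E → ℝ} {x v : E} {d : ℝ}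
    (h : HasDerivAt (fun s : ℝ => G (x + s • v)) d 0) : dirDeriv G x v = d :=
  dirDeriv_eq (hasCurveDerivAt_real.2 h)

theorem dirDeriv_congr {f g : E → F} {W : Set E} (hW : CurveOpen W) {x : E} (hx : x ∈ W)
    (h : ∀ y ∈ W, f y = g y) (v : E) : dirDeriv f x v = dirDeriv g x v := by
  unfold dirDeriv limUnder
  congr 1
  refine Filter.map_congr ?_
  filter_upwards [nhdsWithin_le_nhds (hW.eventually_line hx v)] with s hs
  rw [h _ hs, h _ hx]

theorem clm_dirDeriv {f : E → F} {W : Set E} (hf : SmoothOn f W) (hW : CurveOpen W)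
    {x : E} (hx : x ∈ W) (v : E) (l : F →L[ℝ] ℝ) :
    l (dirDeriv f x v) = dirDeriv (fun y => l (f y)) x v :=
  (dirDeriv_eq_of_hasDerivAt ((hf.hasCurveDerivAt hW hx v).clm l)).symm

/-- A smooth function on a `c^∞`-open set is smooth along smooth surfaces. -/
theorem SmoothOn.contDiffAt_surface {G : E → ℝ} {W : Set E} (hG : SmoothOn G W)
    (hW : CurveOpen W) {σ : ℝ × ℝ → E} (hσ : ∀ l : E →L[ℝ] ℝ, ContDiff ℝ ∞ fun p => l (σ p))
    {p : ℝ × ℝ} (hp : σ p ∈ W) : ContDiffAt ℝ ∞ (fun q => G (σ q)) p := by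
  have hc : ∀ c : ℝ → ℝ × ℝ, ContDiff ℝ ∞ c → SmoothCurve fun t => σ (c t) := fun c hc =>
    smoothCurve_iff.2 fun l => (hσ l).comp hc
  refine contDiffAt_of_curve (A := σ ⁻¹' W)
    (fun c h hW' => smoothCurve_real.1 (hG _ (hc c h) hW')) ?_
  exact (isOpen_of_curve (A := σ ⁻¹' W) fun c h => hW _ (hc c h)).mem_nhds hp

theorem SmoothOn.contDiffAt_plane {G : E → ℝ} {W : Set E} (hG : SmoothOn G W)
    (hW : CurveOpen W) {x : E} (hx : x ∈ W) (u v : E) :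
    ContDiffAt ℝ ∞ (fun q : ℝ × ℝ => G (x + q.1 • u + q.2 • v)) 0 := by
  refine hG.contDiffAt_surface hW (σ := fun q => x + q.1 • u + q.2 • v) (fun l => ?_)
    (by simpa using hx)
  simp only [map_add, map_smul, smul_eq_mul]
  fun_prop

/-- The chain rule along a smooth curve. -/
theorem SmoothOn.hasDerivAt_curve {G : E → ℝ} {W : Set E} (hG : SmoothOn G W)
    (hW : CurveOpen W) {γ : ℝ → E} (hγ : SmoothCurve γ) (h0 : γ 0 ∈ W) {v : E}
    (hv : HasCurveDerivAt γ v 0) :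
    HasDerivAt (fun s => G (γ s)) (dirDeriv G (γ 0) v) 0 := by
  obtain ⟨w, hw, hw0, hγw⟩ := hγ.exists_quotient hv
  -- With `γ s = γ 0 + s • w s`, the function `G ∘ γ` is the diagonal of `K(s, r) = G (γ 0 + s • w
  -- r)`. At the origin the first partial of `K` is the derivative in direction `w 0 = v`, and the
  -- second vanishes because `K(0, r)` is constant.
  have hK : ContDiffAt ℝ ∞ (fun q : ℝ × ℝ => G (γ 0 + q.1 • w q.2)) ((0 : ℝ), (0 : ℝ)) := by
    refine hG.contDiffAt_surface hW (σ := fun q => γ 0 + q.1 • w q.2) (fun l => ?_)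
      (by simpa using h0)
    simp only [map_add, map_smul, smul_eq_mul]
    exact contDiff_const.add (contDiff_fst.mul ((hw.contDiff l).comp contDiff_snd))
  have hd := hK.differentiableAt (by simp)
  have h1 := hasDerivAt_partial_fst hd
  have h2 := hasDerivAt_partial_snd hd
  have h3 := hd.hasFDerivAt.comp_hasDerivAt (f := fun s => (s, s)) (0 : ℝ)
    ((hasDerivAt_id (0 : ℝ)).prodMk (hasDerivAt_id (0 : ℝ)))
  simp only [hw0] at h1
  simp only [zero_smul] at h2
  have e1 := dirDeriv_eq_of_hasDerivAt h1
  have e2 := h2.unique (hasDerivAt_const _ _)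
  have e3 : ((1 : ℝ), (1 : ℝ)) = (1, 0) + (0, 1) := by simp
  rw [e3, map_add, ← e1, e2, add_zero] at h3
  refine h3.congr_of_eventuallyEq (Eventually.of_forall fun s => ?_)
  simp only [Function.comp]
  rw [← hγw]

/-! ### Linearity of the differential, chain rule and product rule. -/

/-- Along `u + v` the function is the diagonal of its restriction to the plane through `x` spanned
by `u` and `v`. That restriction is differentiable by Boman's theorem, so the diagonal derivative is
the sum of the partials. -/
theorem dirDeriv_add {G : E → ℝ} {W : Set E} (hG : SmoothOn G W) (hW : CurveOpen W)
    {x : E} (hx : x ∈ W) (u v : E) :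
    dirDeriv G x (u + v) = dirDeriv G x u + dirDeriv G x v := by
  have hd : DifferentiableAt ℝ (fun q : ℝ × ℝ => G (x + q.1 • u + q.2 • v)) ((0 : ℝ), (0 : ℝ)) :=
    (hG.contDiffAt_plane hW hx u v).differentiableAt (by simp)
  have h1 := hasDerivAt_partial_fst hd
  have h2 := hasDerivAt_partial_snd hd
  have h3 := hd.hasFDerivAt.comp_hasDerivAt (f := fun s => (s, s)) (0 : ℝ)
    ((hasDerivAt_id (0 : ℝ)).prodMk (hasDerivAt_id (0 : ℝ)))
  have e3 : ((1 : ℝ), (1 : ℝ)) = (1, 0) + (0, 1) := by simp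
  rw [e3, map_add] at h3
  simp only [zero_smul, add_zero] at h1 h2
  rw [dirDeriv_eq_of_hasDerivAt h1, dirDeriv_eq_of_hasDerivAt h2]
  refine dirDeriv_eq_of_hasDerivAt (h3.congr_of_eventuallyEq (Eventually.of_forall fun s => ?_))
  simp [add_assoc]

theorem dirDeriv_smul {G : E → ℝ} {W : Set E} (hG : SmoothOn G W) (hW : CurveOpen W)
    {x : E} (hx : x ∈ W) (r : ℝ) (v : E) : dirDeriv G x (r • v) = r * dirDeriv G x v := by
  refine dirDeriv_eq_of_hasDerivAt ?_
  have h := hG.hasDerivAt hW hx v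
  have h0 : HasDerivAt (fun s : ℝ => s * r) r 0 := by
    simpa using (hasDerivAt_id (0 : ℝ)).mul_const r
  have h1 := HasDerivAt.comp (h₂ := fun s : ℝ => G (x + s • v)) (0 : ℝ) (by simpa using h) h0
  rw [mul_comm] at h1
  refine h1.congr_of_eventuallyEq (Eventually.of_forall fun s => ?_)
  simp [smul_smul]

/-- The differential of a smooth map is linear. -/
theorem isLinearMap_dirDeriv {f : E → F} {W : Set E} (hf : SmoothOn f W) (hW : CurveOpen W)
    {x : E} (hx : x ∈ W) : IsLinearMap ℝ (dirDeriv f x) where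
  map_add u v := eq_of_forall_clm fun l => by
    simp only [map_add, clm_dirDeriv hf hW hx, dirDeriv_add (hf.clm l) hW hx]
  map_smul r v := eq_of_forall_clm fun l => by
    simp only [map_smul, clm_dirDeriv hf hW hx, dirDeriv_smul (hf.clm l) hW hx, smul_eq_mul]

/-- The chain rule. -/
theorem dirDeriv_comp {G : F → ℝ} {φ : E → F} {W : Set E} {W' : Set F} (hφ : SmoothOn φ W)
    (hW : CurveOpen W) (hG : SmoothOn G W') (hW' : CurveOpen W') {x : E} (hx : x ∈ W)
    (hx' : φ x ∈ W') (v : E) :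
    dirDeriv (fun y => G (φ y)) x v = dirDeriv G (φ x) (dirDeriv φ x v) := by
  obtain ⟨c, hc, hcx, hcW⟩ := hW.exists_curve (smoothCurve_line x v) (t := 0) (by simpa using hx)
  have hc0 : c 0 = x := by simpa using hcx.eq_of_nhds
  have hd : HasCurveDerivAt (fun s => φ (c s)) (dirDeriv φ x v) 0 :=
    (hφ.hasCurveDerivAt hW hx v).congr (hcx.fun_comp φ)
  have h := hG.hasDerivAt_curve hW' (hφ c hc hcW) (by simpa [hc0] using hx') hd
  rw [hc0] at h
  exact dirDeriv_eq_of_hasDerivAt (h.congr_of_eventuallyEq (hcx.symm.fun_comp fun y => G (φ y)))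

theorem dirDeriv_mul {f g : E → ℝ} {W : Set E} (hf : SmoothOn f W) (hg : SmoothOn g W)
    (hW : CurveOpen W) {x : E} (hx : x ∈ W) (v : E) :
    dirDeriv (fun y => f y * g y) x v = dirDeriv f x v * g x + f x * dirDeriv g x v :=
  dirDeriv_eq_of_hasDerivAt <| by
    have h := (hf.hasDerivAt hW hx v).mul (hg.hasDerivAt hW hx v)
    simp only [zero_smul, add_zero] at h
    exact h

theorem dirDeriv_fun_add {f g : E → ℝ} {W : Set E} (hf : SmoothOn f W) (hg : SmoothOn g W)
    (hW : CurveOpen W) {x : E} (hx : x ∈ W) (v : E) :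
    dirDeriv (fun y => f y + g y) x v = dirDeriv f x v + dirDeriv g x v :=
  dirDeriv_eq_of_hasDerivAt ((hf.hasDerivAt hW hx v).add (hg.hasDerivAt hW hx v))

/-! ### Joint smoothness of iterated derivatives. -/

/-- A family of functions on `W`, depending on parameters in `E`, that is jointly smooth. -/
def JointSmooth {ι : Type*} (P : (ι → E) → E → ℝ) (W : Set E) : Prop :=
  ∀ (u : ι → ℝ → E) (y : ℝ → E), (∀ i, SmoothCurve (u i)) → SmoothCurve y → (∀ t, y t ∈ W) →
    ContDiff ℝ ∞ fun t => P (fun i => u i t) (y t)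

theorem JointSmooth.smoothOn {ι : Type*} {P : (ι → E) → E → ℝ} {W : Set E} (h : JointSmooth P W)
    (u : ι → E) : SmoothOn (P u) W := fun c hc hs =>
  smoothCurve_real.2 (h (fun i _ => u i) c (fun i => smoothCurve_const (u i)) hc hs)

/-- Along curves `u`, `y`, the derivative is `∂K/∂r (s, 0)` for `K(s, r) = P (tail of u(s)) (y(s) +
r • u₀(s))`. Boman's theorem makes `K` smooth near `r = 0`, hence so is this partial derivative in
`s`. The new direction takes index `0`, as the head of the list does in `iterDeriv`. -/
theorem JointSmooth.dirDeriv {m : ℕ} {P : (Fin m → E) → E → ℝ} {W : Set E}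
    (h : JointSmooth P W) (hW : CurveOpen W) :
    JointSmooth (fun (u : Fin (m + 1) → E) x => dirDeriv (P (Fin.tail u)) x (u 0)) W := by
  intro u y hu hy hyW
  rw [contDiff_iff_contDiffAt]
  intro t
  let K : ℝ × ℝ → ℝ := fun q => P (fun i => u i.succ q.1) (y q.1 + q.2 • u 0 q.1)
  have hc : ∀ c : ℝ → ℝ × ℝ, ContDiff ℝ ∞ c →
      SmoothCurve fun s => y (c s).1 + (c s).2 • u 0 (c s).1 :=
    fun c hc => (hy.comp hc.fst).add (SmoothCurve.smul hc.snd ((hu 0).comp hc.fst))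
  have hK : ∀ s, ContDiffAt ℝ ∞ K (s, 0) := by
    intro s
    refine contDiffAt_of_curve (A := (fun q : ℝ × ℝ => y q.1 + q.2 • u 0 q.1) ⁻¹' W)
      (fun c hc' hcW => h _ _ (fun i => (hu i.succ).comp hc'.fst) (hc c hc') hcW) ?_
    exact (isOpen_of_curve (A := (fun q : ℝ × ℝ => y q.1 + q.2 • u 0 q.1) ⁻¹' W)
      fun c hc' => hW _ (hc c hc')).mem_nhds (by simpa using hyW s)
  have hd : ∀ s, Convenient.dirDeriv (P (Fin.tail fun i => u i s)) (y s) (u 0 s) =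
      fderiv ℝ K (s, 0) (0, 1) := fun s =>
    dirDeriv_eq_of_hasDerivAt (hasDerivAt_partial_snd ((hK s).differentiableAt (by simp)))
  simp only [hd]
  have h1 : ContDiffAt ℝ ∞ (fun s : ℝ => fderiv ℝ K (s, 0)) t :=
    ContDiffAt.comp t ((hK t).fderiv_right (m := ∞) (by simp))
      (contDiffAt_id.prodMk contDiffAt_const)
  exact h1.clm_apply contDiffAt_const

theorem SmoothOn.jointSmooth {G : E → ℝ} {W : Set E} (hG : SmoothOn G W) {ι : Type*} :
    JointSmooth (fun _ : ι → E => G) W :=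
  fun _ y _ hy hW => smoothCurve_real.1 (hG y hy hW)

/-- The iterated derivatives of a smooth function are jointly smooth. -/
theorem SmoothOn.jointSmooth_iterDeriv {G : E → ℝ} {W : Set E} (hG : SmoothOn G W)
    (hW : CurveOpen W) (m : ℕ) :
    JointSmooth (fun (u : Fin m → E) => iterDeriv G (List.ofFn u)) W := by
  induction m with
  | zero => simpa [iterDeriv] using hG.jointSmooth
  | succ m ih =>
    have := ih.dirDeriv hW
    simpa [iterDeriv, List.ofFn_succ, Fin.tail_def] using this

theorem SmoothOn.iterDeriv {G : E → ℝ} {W : Set E} (hG : SmoothOn G W) (hW : CurveOpen W)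
    (us : List E) : SmoothOn (iterDeriv G us) W := by
  have := (hG.jointSmooth_iterDeriv hW us.length).smoothOn us.get
  rwa [List.ofFn_get] at this

theorem SmoothOn.dirDeriv_curve {G : E → ℝ} {W : Set E} (hG : SmoothOn G W) (hW : CurveOpen W)
    {y v : ℝ → E} (hy : SmoothCurve y) (hyW : ∀ t, y t ∈ W) (hv : SmoothCurve v) :
    ContDiff ℝ ∞ fun t => dirDeriv G (y t) (v t) := by
  simpa [Convenient.iterDeriv] using
    hG.jointSmooth_iterDeriv hW 1 (fun _ => v) y (fun _ => hv) hy hyW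

theorem SmoothOn.dirDeriv_const {G : E → ℝ} {W : Set E} (hG : SmoothOn G W) (hW : CurveOpen W)
    (v : E) : SmoothOn (fun x => dirDeriv G x v) W :=
  hG.iterDeriv hW [v]

/-- The second derivative is symmetric. -/
theorem dirDeriv_comm {G : E → ℝ} {W : Set E} (hG : SmoothOn G W) (hW : CurveOpen W)
    {x : E} (hx : x ∈ W) (u v : E) :
    dirDeriv (fun y => dirDeriv G y u) x v = dirDeriv (fun y => dirDeriv G y v) x u := by
  have h := deriv_deriv_comm (hG.contDiffAt_plane hW hx v u)
  have e1 : (fun a : ℝ => deriv (fun b : ℝ => G (x + a • v + b • u)) 0) =ᶠ[𝓝 0]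
      fun a => dirDeriv G (x + a • v) u :=
    (hW.eventually_line hx v).mono fun a ha => (hG.hasDerivAt hW ha u).deriv
  have e2 : (fun b : ℝ => deriv (fun a : ℝ => G (x + a • v + b • u)) 0) =ᶠ[𝓝 0]
      fun b => dirDeriv G (x + b • u) v :=
    (hW.eventually_line hx u).mono fun b hb => by
      simp only [add_right_comm x _ (b • u)]
      exact (hG.hasDerivAt hW hb v).deriv
  rw [e1.deriv_eq, e2.deriv_eq, ((hG.dirDeriv_const hW u).hasDerivAt hW hx v).deriv,
    ((hG.dirDeriv_const hW v).hasDerivAt hW hx u).deriv] at h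
  exact h

/-- The derivative of `y ↦ dG(y)(Y(y))`, for a vector field `Y`. -/
theorem dirDeriv_dirDeriv_field {G : E → ℝ} {Y : E → E} {W : Set E} (hG : SmoothOn G W)
    (hY : SmoothOn Y W) (hW : CurveOpen W) {x : E} (hx : x ∈ W) (v : E) :
    dirDeriv (fun y => dirDeriv G y (Y y)) x v =
      dirDeriv (fun y => dirDeriv G y v) x (Y x) + dirDeriv G x (dirDeriv Y x v) := by
  obtain ⟨c, hc, hcx, hcW⟩ := hW.exists_curve (smoothCurve_line x v) (t := 0) (by simpa using hx)
  have hc0 : c 0 = x := by simpa using hcx.eq_of_nhds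
  have hZ := hY c hc hcW
  have hcd : HasCurveDerivAt c v 0 := (hasCurveDerivAt_line x v).congr hcx
  have hZd : HasCurveDerivAt (fun s => Y (c s)) (dirDeriv Y x v) 0 :=
    (hY.hasCurveDerivAt hW hx v).congr (hcx.fun_comp Y)
  -- The identity is the equality of the mixed partials of `K(a, b) = G (c a + b • Y (c a))`:
  -- deriving first in `b` and then in `a` gives the left side.
  have hK : ContDiffAt ℝ ∞ (fun q : ℝ × ℝ => G (c q.1 + q.2 • Y (c q.1))) 0 := by
    refine hG.contDiffAt_surface hW (σ := fun q => c q.1 + q.2 • Y (c q.1)) (fun l => ?_)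
      (by simpa using hcW 0)
    simp only [map_add, map_smul, smul_eq_mul]
    exact ((hc.contDiff l).comp contDiff_fst).add
      (contDiff_snd.mul ((hZ.contDiff l).comp contDiff_fst))
  have h := deriv_deriv_comm hK
  have e1 : (fun a : ℝ => deriv (fun b : ℝ => G (c a + b • Y (c a))) 0) =ᶠ[𝓝 0]
      fun a => dirDeriv G (x + a • v) (Y (x + a • v)) :=
    hcx.mono fun a ha => by
      simp only at ha ⊢
      rw [← ha]
      exact (hG.hasDerivAt hW (hcW a) (Y (c a))).deriv
  -- In the other order, the curve `a ↦ c a + b • Y (c a)` has velocity `v + b • dY(v)`. When the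
  -- result is differentiated at `b = 0`, the factor `b` leaves only `dG(x)(dY(v))` from the second
  -- term.
  have e2 : (fun b : ℝ => deriv (fun a : ℝ => G (c a + b • Y (c a))) 0) =ᶠ[𝓝 0]
      fun b => dirDeriv G (x + b • Y x) v + b * dirDeriv G (x + b • Y x) (dirDeriv Y x v) :=
    (hW.eventually_line hx (Y x)).mono fun b hb => by
      have hγ : SmoothCurve fun a => c a + b • Y (c a) :=
        hc.add (SmoothCurve.smul contDiff_const hZ)
      have hγd : HasCurveDerivAt (fun a => c a + b • Y (c a)) (v + b • dirDeriv Y x v) 0 := by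
        refine (hcd.add (hZd.const_smul b)).congr fun s => ?_
        simp only [smul_sub, smul_add, smul_comm b]
        abel
      have h1 := hG.hasDerivAt_curve hW hγ (by simpa [hc0] using hb) hγd
      simp only [hc0] at h1
      rw [dirDeriv_add hG hW hb, dirDeriv_smul hG hW hb] at h1
      exact h1.deriv
  have d2 := ((hG.dirDeriv_const hW v).hasDerivAt hW hx (Y x)).add
    ((hasDerivAt_id (0 : ℝ)).mul
      ((hG.dirDeriv_const hW (dirDeriv Y x v)).hasDerivAt hW hx (Y x)))
  have d2' := d2.deriv
  simp only [id, zero_smul, add_zero, one_mul, zero_mul] at d2'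
  rw [e1.deriv_eq, e2.deriv_eq] at h
  have hs : SmoothOn (fun y => dirDeriv G y (Y y)) W := fun y hy hyW =>
    smoothCurve_real.2 (hG.dirDeriv_curve hW hy hyW (hY y hy hyW))
  rw [(hs.hasDerivAt hW hx v).deriv] at h
  rw [h]
  exact d2'

end Maps

/-! ### Calculus on convenient manifolds -/

section ManifoldCalculus

set_option linter.unusedSectionVars false

variable {E : Type*} [AddCommGroup E] [Module ℝ E] [TopologicalSpace E] [ConvenientSpace E]
variable {F : Type*} [AddCommGroup F] [Module ℝ F] [TopologicalSpace F] [ConvenientSpace F]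

theorem SmoothOn.mul {f g : E → ℝ} {W : Set E} (hf : SmoothOn f W) (hg : SmoothOn g W) :
    SmoothOn (fun y => f y * g y) W := fun c hc hW =>
  smoothCurve_real.2 ((smoothCurve_real.1 (hf c hc hW)).mul (smoothCurve_real.1 (hg c hc hW)))

theorem SmoothOn.add {f g : E → F} {W : Set E} (hf : SmoothOn f W) (hg : SmoothOn g W) :
    SmoothOn (fun y => f y + g y) W := fun c hc hW => (hf c hc hW).add (hg c hc hW)

theorem SmoothOn.sub {f g : E → F} {W : Set E} (hf : SmoothOn f W) (hg : SmoothOn g W) :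
    SmoothOn (fun y => f y - g y) W := fun c hc hW => (hf c hc hW).sub (hg c hc hW)

theorem SmoothOn.smul {f : E → ℝ} {g : E → F} {W : Set E} (hf : SmoothOn f W)
    (hg : SmoothOn g W) : SmoothOn (fun y => f y • g y) W := fun c hc hW =>
  SmoothCurve.smul (smoothCurve_real.1 (hf c hc hW)) (hg c hc hW)

theorem smoothOn_const (x : F) (W : Set E) : SmoothOn (fun _ => x) W :=
  fun _ _ _ => smoothCurve_const x

theorem SmoothOn.sum {ι : Type*} {s : Finset ι} {f : ι → E → F} {W : Set E}
    (hf : ∀ i ∈ s, SmoothOn (f i) W) : SmoothOn (fun y => ∑ i ∈ s, f i y) W :=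
  fun c hc hW => SmoothCurve.sum fun i hi => hf i hi c hc hW

variable {M : Type*} [TopologicalSpace M]

/-- The `c^∞`-topology is final for smooth curves, so openness in the model is precisely openness
along them. -/
theorem curveOpen_chartSet (e : OpenPartialHomeomorph M (CInf E)) {U : Set M} (hU : IsOpen U) :
    CurveOpen (chartSet e U) := fun c hc =>
  (e.symm.isOpen_inter_preimage hU : IsOpen (e.symm.source ∩ e.symm ⁻¹' U)) c hc

theorem point_coord {e : OpenPartialHomeomorph M (CInf E)} {x : M} (hx : x ∈ e.source) :
    point e (coord e x) = x :=
  e.left_inv hx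

theorem coord_mem_chartSet {e : OpenPartialHomeomorph M (CInf E)} {U : Set M} {x : M}
    (hx : x ∈ e.source) (hU : x ∈ U) : coord e x ∈ chartSet e U :=
  ⟨e.map_source hx, by rwa [point_coord hx]⟩

theorem point_mem_source {e : OpenPartialHomeomorph M (CInf E)} {U : Set M} {y : E}
    (hy : y ∈ chartSet e U) : point e y ∈ e.source :=
  e.map_target hy.1

theorem coord_point {e : OpenPartialHomeomorph M (CInf E)} {U : Set M} {y : E}
    (hy : y ∈ chartSet e U) : coord e (point e y) = y :=
  e.right_inv hy.1

theorem chartSet_mono (e : OpenPartialHomeomorph M (CInf E)) {U V : Set M} (h : U ⊆ V) :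
    chartSet e U ⊆ chartSet e V :=
  fun _ hy => ⟨hy.1, h hy.2⟩

variable [ChartedSpace (CInf E) M]

theorem toChart_self (x : M) (v : E) : toChart (chartAt (CInf E) x) x v = v := by
  have hx := mem_chart_source (CInf E) x
  have h : dirDeriv (fun y => coord (chartAt (CInf E) x) (point (chartAt (CInf E) x) y))
      (coord (chartAt (CInf E) x) x) v = dirDeriv (fun y : E => y) (coord (chartAt (CInf E) x) x) v :=
    dirDeriv_congr (curveOpen_chartSet _ isOpen_univ) (coord_mem_chartSet hx (Set.mem_univ x))
      (fun y hy => coord_point hy) v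
  exact h.trans (dirDeriv_eq (hasCurveDerivAt_line _ v))

theorem SmoothFun.mono {U V : Set M} {f : M → ℝ} (hf : SmoothFun E U f) (h : V ⊆ U) :
    SmoothFun E V f :=
  fun e he => (hf e he).mono (chartSet_mono e h)

theorem IsVectorFieldOn.mono {U V : Set M} {X : M → E} (hX : IsVectorFieldOn U X) (h : V ⊆ U) :
    IsVectorFieldOn V X :=
  fun e he => (hX e he).mono (chartSet_mono e h)

theorem SmoothFun.mul {U : Set M} {f g : M → ℝ} (hf : SmoothFun E U f) (hg : SmoothFun E U g) :
    SmoothFun E U (fun x => f x * g x) :=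
  fun e he => (hf e he).mul (hg e he)

theorem SmoothFun.add {U : Set M} {f g : M → ℝ} (hf : SmoothFun E U f) (hg : SmoothFun E U g) :
    SmoothFun E U (fun x => f x + g x) :=
  fun e he => (hf e he).add (hg e he)

theorem SmoothFun.neg {U : Set M} {f : M → ℝ} (hf : SmoothFun E U f) :
    SmoothFun E U (fun x => - f x) :=
  fun e he => by simpa using (smoothOn_const (0 : ℝ) (chartSet e U)).sub (hf e he)

theorem SmoothFun.sum {ι : Type*} {s : Finset ι} {U : Set M} {f : ι → M → ℝ}
    (hf : ∀ i ∈ s, SmoothFun E U (f i)) : SmoothFun E U (fun x => ∑ i ∈ s, f i x) :=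
  fun e he => SmoothOn.sum fun i hi => hf i hi e he

theorem smoothFun_const (U : Set M) (r : ℝ) : SmoothFun E U (fun _ => r) :=
  fun e _ => smoothOn_const r (chartSet e U)

variable [ConvenientManifold E M]

theorem isLinearMap_toChart {e : OpenPartialHomeomorph M (CInf E)} (he : e ∈ atlas (CInf E) M)
    {x : M} (hx : x ∈ e.source) : IsLinearMap ℝ (toChart (E := E) e x) :=
  isLinearMap_dirDeriv (ConvenientManifold.smooth_transition _ (chart_mem_atlas _ x) e he)
    (curveOpen_chartSet _ e.open_source) (coord_mem_chartSet (mem_chart_source _ x) hx)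

/-- The differential can be computed in any chart. -/
theorem diff_eq {U : Set M} (hU : IsOpen U) {f : M → ℝ} (hf : SmoothFun E U f)
    {e : OpenPartialHomeomorph M (CInf E)} (he : e ∈ atlas (CInf E) M) {x : M} (hxU : x ∈ U)
    (hx : x ∈ e.source) (v : E) :
    diff f x v = dirDeriv (fun y => f (point e y)) (coord e x) (toChart e x v) := by
  have hW := curveOpen_chartSet (E := E) (chartAt (CInf E) x) (hU.inter e.open_source)
  have hm := coord_mem_chartSet (mem_chart_source (CInf E) x) (U := U ∩ e.source) ⟨hxU, hx⟩
  have hp : point (chartAt (CInf E) x) (coord (chartAt (CInf E) x) x) = x :=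
    point_coord (mem_chart_source (CInf E) x)
  have hφ := (ConvenientManifold.smooth_transition _ (chart_mem_atlas (CInf E) x) e he).mono
    (chartSet_mono _ (Set.inter_subset_right (s := U)))
  have h1 := dirDeriv_congr hW hm (f := fun y => f (point (chartAt (CInf E) x) y))
    (g := fun y => f (point e (coord e (point (chartAt (CInf E) x) y))))
    (fun y hy => by rw [point_coord hy.2.2]) v
  have h2 := dirDeriv_comp hφ hW (hf e he) (curveOpen_chartSet e hU) hm
    (by rw [hp]; exact coord_mem_chartSet hx hxU) v
  rw [hp] at h2
  exact h1.trans h2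

theorem diff_point {U : Set M} (hU : IsOpen U) {f : M → ℝ} (hf : SmoothFun E U f)
    {e : OpenPartialHomeomorph M (CInf E)} (he : e ∈ atlas (CInf E) M) {y : E}
    (hy : y ∈ chartSet e U) (v : E) :
    diff f (point e y) v =
      dirDeriv (fun y => f (point e y)) y (toChart e (point e y) v) := by
  rw [diff_eq hU hf he hy.2 (point_mem_source hy), coord_point hy]

theorem isLinearMap_diff {U : Set M} (hU : IsOpen U) {f : M → ℝ} (hf : SmoothFun E U f) {x : M}
    (hx : x ∈ U) : IsLinearMap ℝ (diff (E := E) f x) :=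
  isLinearMap_dirDeriv (hf _ (chart_mem_atlas (CInf E) x)) (curveOpen_chartSet _ hU)
    (coord_mem_chartSet (mem_chart_source _ x) hx)

theorem diff_mul {U : Set M} (hU : IsOpen U) {f g : M → ℝ} (hf : SmoothFun E U f)
    (hg : SmoothFun E U g) {x : M} (hx : x ∈ U) (v : E) :
    diff (fun z => f z * g z) x v = diff f x v * g x + f x * diff g x v := by
  have h := dirDeriv_mul (hf _ (chart_mem_atlas (CInf E) x)) (hg _ (chart_mem_atlas (CInf E) x))
    (curveOpen_chartSet _ hU) (coord_mem_chartSet (mem_chart_source _ x) hx) v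
  rwa [point_coord (mem_chart_source (CInf E) x)] at h

theorem diff_add {U : Set M} (hU : IsOpen U) {f g : M → ℝ} (hf : SmoothFun E U f)
    (hg : SmoothFun E U g) {x : M} (hx : x ∈ U) (v : E) :
    diff (fun z => f z + g z) x v = diff f x v + diff g x v :=
  dirDeriv_fun_add (hf _ (chart_mem_atlas (CInf E) x)) (hg _ (chart_mem_atlas (CInf E) x))
    (curveOpen_chartSet _ hU) (coord_mem_chartSet (mem_chart_source _ x) hx) v

theorem diff_congr {U : Set M} (hU : IsOpen U) {f g : M → ℝ} (h : ∀ z ∈ U, f z = g z) {x : M}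
    (hx : x ∈ U) (v : E) : diff f x v = diff g x v :=
  dirDeriv_congr (curveOpen_chartSet _ hU) (coord_mem_chartSet (mem_chart_source _ x) hx)
    (fun _ hy => h _ hy.2) v

theorem diff_const (r : ℝ) (x : M) (v : E) : diff (fun _ : M => r) x v = 0 :=
  dirDeriv_eq_of_hasDerivAt (hasDerivAt_const _ _)

theorem fieldApply_point {U : Set M} (hU : IsOpen U) {f : M → ℝ} (hf : SmoothFun E U f)
    (X : M → E) {e : OpenPartialHomeomorph M (CInf E)} (he : e ∈ atlas (CInf E) M) {y : E}
    (hy : y ∈ chartSet e U) :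
    fieldApply X f (point e y) = dirDeriv (fun y => f (point e y)) y (chartRep e X y) :=
  diff_point hU hf he hy _

theorem smoothFun_fieldApply {U : Set M} (hU : IsOpen U) {f : M → ℝ} (hf : SmoothFun E U f)
    {X : M → E} (hX : IsVectorFieldOn U X) : SmoothFun E U (fieldApply X f) := by
  intro e he
  have h : SmoothOn (fun y => dirDeriv (fun y => f (point e y)) y (chartRep e X y))
      (chartSet e U) := fun y hy hyW => smoothCurve_real.2 <|
    (hf e he).dirDeriv_curve (v := fun t => chartRep e X (y t)) (curveOpen_chartSet e hU) hy hyW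
      (hX e he y hy hyW)
  exact h.congr fun _ hy => fieldApply_point hU hf X he hy

theorem IsVectorFieldOn.add {U : Set M} {X Y : M → E} (hX : IsVectorFieldOn U X)
    (hY : IsVectorFieldOn U Y) : IsVectorFieldOn U fun x => X x + Y x := fun e he =>
  ((hX e he).add (hY e he)).congr fun _ hy =>
    (isLinearMap_toChart he (point_mem_source hy)).map_add _ _

theorem IsVectorFieldOn.smul {U : Set M} {f : M → ℝ} {X : M → E} (hf : SmoothFun E U f)
    (hX : IsVectorFieldOn U X) : IsVectorFieldOn U fun x => f x • X x := fun e he =>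
  ((hf e he).smul (hX e he)).congr fun _ hy =>
    (isLinearMap_toChart he (point_mem_source hy)).map_smul _ _

theorem IsVectorFieldOn.sum {ι : Type*} {s : Finset ι} {U : Set M} {X : ι → M → E}
    (hX : ∀ i ∈ s, IsVectorFieldOn U (X i)) : IsVectorFieldOn U fun x => ∑ i ∈ s, X i x :=
  fun e he => (SmoothOn.sum fun i hi => hX i hi e he).congr fun _ hy =>
    map_sum (IsLinearMap.mk' _ (isLinearMap_toChart he (point_mem_source hy))) _ _

theorem IsVectorFieldOn.congr {U : Set M} {X Y : M → E} (hX : IsVectorFieldOn U X)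
    (h : ∀ x ∈ U, Y x = X x) : IsVectorFieldOn U Y := fun e he =>
  (hX e he).congr fun _ hy => congrArg (toChart e _) (h _ hy.2)

/-- The Lie bracket acts on functions as the commutator. -/
theorem diff_lieBracket {U : Set M} (hU : IsOpen U) {f : M → ℝ} (hf : SmoothFun E U f)
    {X Y : M → E} (hX : IsVectorFieldOn U X) (hY : IsVectorFieldOn U Y) {x : M} (hx : x ∈ U) :
    diff f x (lieBracket X Y x) =
      diff (fieldApply Y f) x (X x) - diff (fieldApply X f) x (Y x) := by
  have he := chart_mem_atlas (CInf E) x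
  have hxe := mem_chart_source (CInf E) x
  have hW := curveOpen_chartSet (E := E) (chartAt (CInf E) x) hU
  have hm : coord (chartAt (CInf E) x) x ∈ chartSet (chartAt (CInf E) x) U :=
    coord_mem_chartSet hxe hx
  -- In the preferred chart `v(Z f) = d²f(Z, v) + df(dZ(v))`. In the commutator the second-order
  -- terms cancel by symmetry and the first-order ones form the bracket.
  have key : ∀ (Z : M → E), IsVectorFieldOn U Z → ∀ v : E, diff (fieldApply Z f) x v =
      dirDeriv (fun y => dirDeriv (fun y => f (point (chartAt (CInf E) x) y)) y v)
        (coord (chartAt (CInf E) x) x) (Z x) +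
      diff f x (dirDeriv (chartRep (chartAt (CInf E) x) Z) (coord (chartAt (CInf E) x) x) v) := by
    intro Z hZ v
    have h1 := dirDeriv_congr hW hm (fun y hy => fieldApply_point hU hf Z he hy) v
    have h2 := dirDeriv_dirDeriv_field (hf _ he) (hZ _ he) hW hm v
    have h3 : chartRep (chartAt (CInf E) x) Z (coord (chartAt (CInf E) x) x) = Z x := by
      unfold chartRep
      rw [point_coord hxe, toChart_self]
    rw [h3] at h2
    exact h1.trans h2
  rw [key X hX, key Y hY, dirDeriv_comm (hf _ he) hW hm (X x) (Y x)]
  unfold lieBracket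
  rw [(isLinearMap_diff hU hf hx).map_sub]
  ring

end ManifoldCalculus

/-! ### The algebra `𝔄(U)` -/

/-- All the ways to split a list into two complementary sublists. -/
def splits {α : Type*} : List α → List (List α × List α)
  | [] => [([], [])]
  | u :: us => (splits us).flatMap fun p => [(u :: p.1, p.2), (p.1, u :: p.2)]

/-- Splittings of the moving directions `uᵢ(t)` can thus be indexed by splittings of the list of
indices, which does not depend on `t`. -/
theorem splits_map {α β : Type*} (φ : α → β) (us : List α) :
    splits (us.map φ) = (splits us).map (Prod.map (List.map φ) (List.map φ)) := by
  induction us with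
  | nil => rfl
  | cons u us ih =>
    simp only [List.map_cons, splits, ih, List.flatMap_map, List.map_flatMap]
    rfl

theorem sum_map_flatMap_pair {α β : Type*} [AddCommMonoid β] (L : List α) {γ : Type*}
    (a b : α → γ) (f : γ → β) :
    ((L.flatMap fun p => [a p, b p]).map f).sum = (L.map fun p => f (a p) + f (b p)).sum := by
  induction L with
  | nil => rfl
  | cons p L ih => simp [ih, add_assoc]

theorem ofFn_get_map {α β : Type*} (a : List α) (φ : α → β) :
    List.ofFn (fun i => φ (a.get i)) = a.map φ := by
  have := List.map_ofFn (f := a.get) (g := φ)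
  rw [List.ofFn_get] at this
  exact this.symm

section Algebra

set_option linter.unusedSectionVars false

variable {E : Type*} [AddCommGroup E] [Module ℝ E] [TopologicalSpace E] [ConvenientSpace E]
variable {F : Type*} [AddCommGroup F] [Module ℝ F] [TopologicalSpace F] [ConvenientSpace F]

/-! ### The Leibniz rule for iterated derivatives. -/

theorem SmoothCurve.list_sum {κ : Type*} (L : List κ) {c : κ → ℝ → F}
    (hc : ∀ k, SmoothCurve (c k)) : SmoothCurve fun t => (L.map fun k => c k t).sum := by
  induction L with
  | nil => exact smoothCurve_const 0
  | cons k L ih => simpa using (hc k).add ih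

theorem SmoothOn.list_sum {κ : Type*} (L : List κ) {f : κ → E → F} {W : Set E}
    (hf : ∀ k, SmoothOn (f k) W) : SmoothOn (fun y => (L.map fun k => f k y).sum) W :=
  fun c hc hW => SmoothCurve.list_sum L fun k => hf k c hc hW

theorem dirDeriv_list_sum {κ : Type*} (L : List κ) {f : κ → E → ℝ} {W : Set E}
    (hf : ∀ k, SmoothOn (f k) W) (hW : CurveOpen W) {x : E} (hx : x ∈ W) (v : E) :
    dirDeriv (fun y => (L.map fun k => f k y).sum) x v =
      (L.map fun k => dirDeriv (f k) x v).sum := by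
  induction L with
  | nil => exact dirDeriv_eq_of_hasDerivAt (hasDerivAt_const _ _)
  | cons k L ih =>
    simp only [List.map_cons, List.sum_cons]
    rw [dirDeriv_fun_add (hf k) (SmoothOn.list_sum L hf) hW hx, ih]

theorem dirDeriv_list_sum_mul {κ : Type*} (L : List κ) {f g : κ → E → ℝ} {W : Set E}
    (hf : ∀ k, SmoothOn (f k) W) (hg : ∀ k, SmoothOn (g k) W) (hW : CurveOpen W) {x : E}
    (hx : x ∈ W) (v : E) :
    dirDeriv (fun y => (L.map fun k => f k y * g k y).sum) x v =
      (L.map fun k => dirDeriv (f k) x v * g k x + f k x * dirDeriv (g k) x v).sum := by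
  rw [dirDeriv_list_sum L (fun k => (hf k).mul (hg k)) hW hx]
  congr 2; funext k
  exact dirDeriv_mul (hf k) (hg k) hW hx v

/-- The Leibniz rule for iterated derivatives. -/
theorem iterDeriv_mul {f g : E → ℝ} {W : Set E} (hf : SmoothOn f W) (hg : SmoothOn g W)
    (hW : CurveOpen W) (us : List E) {x : E} (hx : x ∈ W) :
    iterDeriv (fun y => f y * g y) us x =
      ((splits us).map fun p => iterDeriv f p.1 x * iterDeriv g p.2 x).sum := by
  induction us generalizing x with
  | nil => simp [splits, iterDeriv]
  | cons u us ih =>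
    rw [splits, sum_map_flatMap_pair]
    have h1 := dirDeriv_congr hW hx (fun y hy => ih hy) u
    have h2 := dirDeriv_list_sum_mul (splits us) (f := fun p => iterDeriv f p.1)
      (g := fun p => iterDeriv g p.2) (fun p => hf.iterDeriv hW p.1)
      (fun p => hg.iterDeriv hW p.2) hW hx u
    exact h1.trans h2

theorem iterDeriv_linear {f g : E → ℝ} {W : Set E} (hf : SmoothOn f W) (hg : SmoothOn g W)
    (hW : CurveOpen W) (r s : ℝ) (us : List E) {x : E} (hx : x ∈ W) :
    iterDeriv (fun y => r * f y + s * g y) us x =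
      r * iterDeriv f us x + s * iterDeriv g us x := by
  induction us generalizing x with
  | nil => rfl
  | cons u us ih =>
    refine (dirDeriv_congr hW hx (fun y hy => ih hy) u).trans (dirDeriv_eq_of_hasDerivAt ?_)
    exact (((hf.iterDeriv hW us).hasDerivAt hW hx u).const_mul r).add
      (((hg.iterDeriv hW us).hasDerivAt hW hx u).const_mul s)

theorem SmoothOn.iterDeriv_curve {G : E → ℝ} {W : Set E} (hG : SmoothOn G W) (hW : CurveOpen W)
    {κ : Type*} {u : κ → ℝ → E} (hu : ∀ k, SmoothCurve (u k)) (a : List κ) {y : ℝ → E}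
    (hy : SmoothCurve y) (hyW : ∀ t, y t ∈ W) :
    ContDiff ℝ ∞ fun t => Convenient.iterDeriv G (a.map fun k => u k t) (y t) := by
  have h := hG.jointSmooth_iterDeriv hW a.length (fun i => u (a.get i)) y (fun i => hu _) hy hyW
  have e : ∀ t, List.ofFn (fun i => u (a.get i) t) = a.map fun k => u k t := fun t =>
    ofFn_get_map a fun k => u k t
  simpa only [e] using h

variable {M : Type*} [TopologicalSpace M] [ChartedSpace (CInf E) M]

/-! ### Jets as curves in the typical fibre, and the algebra structure. -/

theorem WeakSubbundle.exists_param (T : WeakSubbundle E M F) {p x : M} (hx : x ∈ T.baseSet p)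
    {α : E → ℝ} (hα : α ∈ T.fiber x) : ∃ ξ, T.param p x ξ = α := by
  rw [← T.range_param p x hx] at hα
  exact hα

variable {T : WeakSubbundle E M F} {U : Set M}

theorem MemA.mono {V : Set M} {f : M → ℝ} (hf : MemA T U f) (h : V ⊆ U) : MemA T V f where
  smooth := hf.smooth.mono h
  mem e he x hx us := hf.mem e he x ⟨h hx.1, hx.2⟩ us
  smooth_jet p e he m y u ψ hy hyU hu hψ := hf.smooth_jet p e he m y u ψ hy
    (fun t => chartSet_mono e (Set.inter_subset_inter_left _ h) (hyU t)) hu hψ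

/-- `MemA.smooth_jet` only asserts smoothness of a given lift to the typical fibre; the lift exists
because `param` is onto the fibre. The list `a` of indices is arbitrary, so each sublist occurring
in a Leibniz sum is covered. -/
theorem MemA.exists_param_curve {f : M → ℝ} (hf : MemA T U f) (p : M)
    {e : OpenPartialHomeomorph M (CInf E)} (he : e ∈ atlas (CInf E) M) {y : ℝ → E}
    (hy : SmoothCurve y) (hyU : ∀ t, y t ∈ chartSet e (U ∩ T.baseSet p)) {κ : Type*}
    {u : κ → ℝ → E} (hu : ∀ k, SmoothCurve (u k)) (a : List κ) :
    ∃ ψ : ℝ → F, SmoothCurve ψ ∧ ∀ t, T.param p (point e (y t)) (ψ t) =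
      jetCovector e f (a.map fun k => u k t) (point e (y t)) := by
  have h : ∀ t, ∃ ξ, T.param p (point e (y t)) ξ =
      jetCovector e f (a.map fun k => u k t) (point e (y t)) := fun t =>
    T.exists_param (hyU t).2.2 (hf.mem e he _ ⟨(hyU t).2.1, point_mem_source (hyU t)⟩ _)
  choose ψ hψ using h
  refine ⟨ψ, hf.smooth_jet p e he a.length y (fun i => u (a.get i)) ψ hy hyU
    (fun i => hu _) fun t => ?_, hψ⟩
  rw [hψ, ofFn_get_map a fun k => u k t]

/-- Injectivity of `param` transports the relation to the typical fibre, where `ψ` becomes a finite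
sum of smooth curves with smooth coefficients. -/
theorem smoothCurve_of_param_eq_sum {p : M} {e : OpenPartialHomeomorph M (CInf E)} {y : ℝ → E}
    (hyU : ∀ t, y t ∈ chartSet e (U ∩ T.baseSet p)) {κ : Type*} (L : List κ)
    {a : κ → ℝ → ℝ} {φ : κ → ℝ → F} (ha : ∀ k, ContDiff ℝ ∞ (a k)) (hφ : ∀ k, SmoothCurve (φ k))
    {ψ : ℝ → F} (hψ : ∀ t, T.param p (point e (y t)) (ψ t) =
      (L.map fun k => a k t • T.param p (point e (y t)) (φ k t)).sum) : SmoothCurve ψ := by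
  have h : ψ = fun t => (L.map fun k => a k t • φ k t).sum := by
    funext t
    refine T.param_injective p _ (hyU t).2.2 ?_
    rw [hψ, map_list_sum, List.map_map]
    congr 2; funext k
    simp
  rw [h]
  exact SmoothCurve.list_sum L fun k => SmoothCurve.smul (ha k) (hφ k)

/-- In each Leibniz term the free direction falls on exactly one of the factors. That factor is a
jet covector and the other is a scalar, which is why the product stays in the fibre. -/
theorem jetCovector_mul (hU : IsOpen U) {f g : M → ℝ} (hf : SmoothFun E U f)
    (hg : SmoothFun E U g) {e : OpenPartialHomeomorph M (CInf E)} (he : e ∈ atlas (CInf E) M)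
    {x : M} (hx : x ∈ U ∩ e.source) (us : List E) :
    jetCovector e (fun z => f z * g z) us x =
      ((splits us).map fun p =>
        iterDeriv (fun y => g (point e y)) p.2 (coord e x) • jetCovector e f p.1 x +
        iterDeriv (fun y => f (point e y)) p.1 (coord e x) • jetCovector e g p.2 x).sum := by
  funext v
  have hW := curveOpen_chartSet e hU
  have hm := coord_mem_chartSet hx.2 hx.1
  have h := iterDeriv_mul (hf e he) (hg e he) hW (toChart e x v :: us) hm
  rw [splits, sum_map_flatMap_pair] at h
  have hs : ∀ (L : List (E → ℝ)), L.sum v = (L.map fun α => α v).sum := fun L => by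
    induction L with
    | nil => rfl
    | cons α L ih => simp [ih]
  rw [hs, List.map_map]
  refine h.trans ?_
  congr 2; funext p
  simp [jetCovector, mul_comm]

theorem MemA.mul (hU : IsOpen U) {f g : M → ℝ} (hf : MemA T U f) (hg : MemA T U g) :
    MemA T U (fun x => f x * g x) where
  smooth := hf.smooth.mul hg.smooth
  mem e he x hx us := by
    rw [jetCovector_mul hU hf.smooth hg.smooth he hx]
    refine list_sum_mem fun α hα => ?_
    obtain ⟨p, -, rfl⟩ := List.mem_map.1 hα
    exact add_mem (Submodule.smul_mem _ _ (hf.mem e he x hx _))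
      (Submodule.smul_mem _ _ (hg.mem e he x hx _))
  smooth_jet p e he m y u ψ hy hyU hu hψ := by
    have hW := curveOpen_chartSet (E := E) e hU
    have hyW : ∀ t, y t ∈ chartSet e U := fun t =>
      chartSet_mono e Set.inter_subset_left (hyU t)
    choose φ hφ hφe using fun a => hf.exists_param_curve p he hy hyU hu a
    choose χ hχ hχe using fun a => hg.exists_param_curve p he hy hyU hu a
    -- Each splitting of the indices gives two terms: `inl` when the free direction falls on `f`,
    -- `inr` when it falls on `g`.
    refine smoothCurve_of_param_eq_sum hyU
      ((splits (List.finRange m)).flatMap fun q => [Sum.inl q, Sum.inr q])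
      (a := Sum.elim
        (fun q t => iterDeriv (fun y => g (point e y)) (q.2.map fun i => u i t) (y t))
        (fun q t => iterDeriv (fun y => f (point e y)) (q.1.map fun i => u i t) (y t)))
      (φ := Sum.elim (fun q => φ q.1) fun q => χ q.2) ?_ ?_ fun t => ?_
    · rintro (q | q)
      · exact (hg.smooth e he).iterDeriv_curve hW hu q.2 hy hyW
      · exact (hf.smooth e he).iterDeriv_curve hW hu q.1 hy hyW
    · rintro (q | q)
      · exact hφ q.1
      · exact hχ q.2
    · rw [hψ, jetCovector_mul hU hf.smooth hg.smooth he
        ⟨(hyW t).2, point_mem_source (hyW t)⟩, List.ofFn_eq_map, splits_map,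
        sum_map_flatMap_pair, List.map_map, coord_point (hyW t)]
      congr 2; funext q
      simp [hφe, hχe]

theorem jetCovector_linear (hU : IsOpen U) {f g : M → ℝ} (hf : SmoothFun E U f)
    (hg : SmoothFun E U g) {e : OpenPartialHomeomorph M (CInf E)} (he : e ∈ atlas (CInf E) M)
    {x : M} (hx : x ∈ U ∩ e.source) (r s : ℝ) (us : List E) :
    jetCovector e (fun z => r * f z + s * g z) us x =
      r • jetCovector e f us x + s • jetCovector e g us x := by
  funext v
  exact iterDeriv_linear (hf e he) (hg e he) (curveOpen_chartSet e hU) r s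
    (toChart e x v :: us) (coord_mem_chartSet hx.2 hx.1)

theorem MemA.linear (hU : IsOpen U) {f g : M → ℝ} (hf : MemA T U f) (hg : MemA T U g)
    (r s : ℝ) : MemA T U (fun x => r * f x + s * g x) where
  smooth := ((smoothFun_const U r).mul hf.smooth).add ((smoothFun_const U s).mul hg.smooth)
  mem e he x hx us := by
    rw [jetCovector_linear hU hf.smooth hg.smooth he hx]
    exact add_mem (Submodule.smul_mem _ _ (hf.mem e he x hx _))
      (Submodule.smul_mem _ _ (hg.mem e he x hx _))
  smooth_jet p e he m y u ψ hy hyU hu hψ := by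
    have hyW : ∀ t, y t ∈ chartSet e U := fun t =>
      chartSet_mono e Set.inter_subset_left (hyU t)
    obtain ⟨φ, hφ, hφe⟩ := hf.exists_param_curve p he hy hyU hu (List.finRange m)
    obtain ⟨χ, hχ, hχe⟩ := hg.exists_param_curve p he hy hyU hu (List.finRange m)
    refine smoothCurve_of_param_eq_sum hyU [true, false]
      (a := fun b _ => cond b r s) (φ := fun b => cond b φ χ) (fun _ => contDiff_const)
      (fun b => by cases b <;> assumption) fun t => ?_
    rw [hψ, jetCovector_linear hU hf.smooth hg.smooth he ⟨(hyW t).2, point_mem_source (hyW t)⟩,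
      List.ofFn_eq_map]
    simp [hφe, hχe]

theorem MemA.add (hU : IsOpen U) {f g : M → ℝ} (hf : MemA T U f) (hg : MemA T U g) :
    MemA T U (fun x => f x + g x) := by
  simpa using hf.linear hU hg 1 1

theorem MemA.sub (hU : IsOpen U) {f g : M → ℝ} (hf : MemA T U f) (hg : MemA T U g) :
    MemA T U (fun x => f x - g x) := by
  simpa [sub_eq_add_neg] using hf.linear hU hg 1 (-1)

variable [ConvenientManifold E M]

theorem jetCovector_nil (hU : IsOpen U) {f : M → ℝ} (hf : SmoothFun E U f)
    {e : OpenPartialHomeomorph M (CInf E)} (he : e ∈ atlas (CInf E) M) {x : M}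
    (hx : x ∈ U ∩ e.source) : jetCovector e f [] x = diff f x :=
  funext fun v => (diff_eq hU hf he hx.1 hx.2 v).symm

theorem MemA.diff_mem (hU : IsOpen U) {f : M → ℝ} (hf : MemA T U f) {x : M} (hx : x ∈ U) :
    diff f x ∈ T.fiber x := by
  have hx' : x ∈ U ∩ (chartAt (CInf E) x).source := ⟨hx, mem_chart_source _ x⟩
  rw [← jetCovector_nil hU hf.smooth (chart_mem_atlas _ x) hx']
  exact hf.mem _ (chart_mem_atlas _ x) x hx' []

end Algebra

/-! ### Partial Jacobi manifolds -/

section JacobiManifold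

set_option linter.unusedSectionVars false

variable {E : Type*} [AddCommGroup E] [Module ℝ E] [TopologicalSpace E] [ConvenientSpace E]
variable {M : Type*} [TopologicalSpace M] [ChartedSpace (CInf E) M] [ConvenientManifold E M]
variable {F : Type*} [AddCommGroup F] [Module ℝ F] [TopologicalSpace F] [ConvenientSpace F]
variable {U : Set M}

/-- Smoothness along a curve is local, so the curve may be taken in the base set of one
trivialization. There `df` lifts to a smooth curve in the typical fibre, and `smooth_sharp` applies.
-/
theorem AdmissibleBivector.isVectorFieldOn_sharpD (L : AdmissibleBivector E M F) (hU : IsOpen U)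
    {f : M → ℝ} (hf : MemA L.bundle U f) : IsVectorFieldOn U (L.sharpD f) := by
  intro e he y hy hyU
  refine smoothCurve_of_locally fun t => ?_
  obtain ⟨c, hc, hcy, hcW⟩ := (curveOpen_chartSet (E := E) e
    (hU.inter (L.bundle.isOpen_baseSet (point e (y t))))).exists_curve hy (t := t)
    ⟨(hyU t).1, (hyU t).2, L.bundle.mem_baseSet _⟩
  -- The jet with no further directions is `df` itself, hence the empty index type.
  obtain ⟨ψ, hψ, hψe⟩ := hf.exists_param_curve (point e (y t)) he hc hcW
    (κ := Empty) (u := fun k => k.elim) (fun k => k.elim) []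
  refine ⟨_, L.smooth_sharp (point e (y t)) e he c ψ hc
    (fun s => chartSet_mono e Set.inter_subset_right (hcW s)) hψ, ?_⟩
  filter_upwards [hcy] with s hs
  rw [hψe, List.map_nil, jetCovector_nil hU hf.smooth he
    ⟨(hcW s).2.1, point_mem_source (hcW s)⟩, hs]
  rfl

/-- Polarization of `Λ(α + β, α + β) = 0` at `α = df`, `β = dg`. Both lie in the fibre, so
`extendSharp` does not take its default value. -/
theorem AdmissibleBivector.apply_comm (L : AdmissibleBivector E M F) (hU : IsOpen U)
    {f g : M → ℝ} (hf : MemA L.bundle U f) (hg : MemA L.bundle U g) {x : M} (hx : x ∈ U) :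
    L.apply f g x = - L.apply g f x := by
  let α : L.bundle.fiber x := ⟨diff f x, hf.diff_mem hU hx⟩
  let β : L.bundle.fiber x := ⟨diff g x, hg.diff_mem hU hx⟩
  have e1 : L.sharpD f x = L.sharp x α := dif_pos _
  have e2 : L.sharpD g x = L.sharp x β := dif_pos _
  have h := L.alternating x (α + β)
  have hα : diff f x (L.sharp x α) = 0 := L.alternating x α
  have hβ : diff g x (L.sharp x β) = 0 := L.alternating x β
  have h' : diff f x (L.sharp x α + L.sharp x β) + diff g x (L.sharp x α + L.sharp x β) = 0 := by
    rw [map_add] at h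
    exact h
  rw [(isLinearMap_diff hU hf.smooth hx).map_add, (isLinearMap_diff hU hg.smooth hx).map_add,
    hα, hβ] at h'
  unfold AdmissibleBivector.apply
  rw [e1, e2]
  linarith

/-- Test functions may be restricted to `U ∩ V`, so it is enough to test on neighbourhoods inside
`U`, where the fields under study are defined and smooth. -/
theorem WeakSubbundle.Separating.eq {T : WeakSubbundle E M F} (hT : T.Separating) (hU : IsOpen U)
    {x : M} (hx : x ∈ U) {v w : E}
    (h : ∀ V : Set M, IsOpen V → V ⊆ U → x ∈ V → ∀ f, MemA T V f → diff f x v = diff f x w) :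
    v = w := by
  refine sub_eq_zero.1 (hT x _ fun V hV hxV f hf => ?_)
  have hf' := hf.mono (Set.inter_subset_right (s := U))
  rw [(isLinearMap_diff hV hf.smooth hxV).map_sub,
    h (U ∩ V) (hU.inter hV) Set.inter_subset_left ⟨hx, hxV⟩ f hf', sub_self]

namespace PartialJacobi

variable (J : PartialJacobi E M F)

/-! ### The Jacobi bracket and the Hamiltonian vector fields. -/

theorem bracket_mem (hU : IsOpen U) {f g : M → ℝ} (hf : MemA J.bundle U f)
    (hg : MemA J.bundle U g) : MemA J.bundle U (J.bracket f g) :=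
  ((J.apply_mem U hU f g hf hg).add hU (hf.mul hU (J.reeb_mem U hU g hg))).sub hU
    (hg.mul hU (J.reeb_mem U hU f hf))

theorem isVectorFieldOn_hamiltonian (hU : IsOpen U) {f : M → ℝ} (hf : MemA J.bundle U f) :
    IsVectorFieldOn U (J.hamiltonian f) :=
  (J.isVectorFieldOn_sharpD hU hf).add
    (IsVectorFieldOn.smul hf.smooth (J.reeb_smooth.mono (Set.subset_univ U)))

theorem diff_hamiltonian (hU : IsOpen U) {k : M → ℝ} (hk : SmoothFun E U k) (f : M → ℝ) {x : M}
    (hx : x ∈ U) :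
    diff k x (J.hamiltonian f x) = J.apply f k x + f x * fieldApply J.reeb k x := by
  have h := isLinearMap_diff hU hk hx
  unfold hamiltonian
  rw [h.map_add, h.map_smul]
  rfl

theorem diff_fieldApply_hamiltonian (hU : IsOpen U) {g h : M → ℝ} (hg : MemA J.bundle U g)
    (hh : MemA J.bundle U h) {x : M} (hx : x ∈ U) (v : E) :
    diff (fieldApply (J.hamiltonian g) h) x v = diff (J.apply g h) x v +
      (diff g x v * fieldApply J.reeb h x + g x * diff (fieldApply J.reeb h) x v) := by
  have hE := (J.reeb_mem U hU h hh).smooth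
  have e : ∀ z ∈ U, fieldApply (J.hamiltonian g) h z =
      J.apply g h z + g z * fieldApply J.reeb h z :=
    fun z hz => J.diff_hamiltonian hU hh.smooth g hz
  rw [diff_congr hU e hx v, diff_add hU (J.apply_mem U hU g h hg hh).smooth (hg.smooth.mul hE) hx,
    diff_mul hU hg.smooth hE hx]

theorem diff_bracket (hU : IsOpen U) {f g : M → ℝ} (hf : MemA J.bundle U f)
    (hg : MemA J.bundle U g) {x : M} (hx : x ∈ U) (v : E) :
    diff (J.bracket f g) x v = diff (J.apply f g) x v +
      (diff f x v * fieldApply J.reeb g x + f x * diff (fieldApply J.reeb g) x v) -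
      (diff g x v * fieldApply J.reeb f x + g x * diff (fieldApply J.reeb f) x v) := by
  have hEf := (J.reeb_mem U hU f hf).smooth
  have hEg := (J.reeb_mem U hU g hg).smooth
  have hA := (J.apply_mem U hU f g hf hg).smooth
  have e : J.bracket f g = fun z =>
      (J.apply f g z + f z * fieldApply J.reeb g z) + (-1) * (g z * fieldApply J.reeb f z) := by
    funext z
    simp only [bracket, Pi.add_apply, Pi.sub_apply, Pi.mul_apply]
    ring
  rw [e, diff_add hU (hA.add (hf.smooth.mul hEg))
      ((smoothFun_const U (-1)).mul (hg.smooth.mul hEf)) hx,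
    diff_add hU hA (hf.smooth.mul hEg) hx, diff_mul hU hf.smooth hEg hx,
    diff_mul hU (smoothFun_const U (-1)) (hg.smooth.mul hEf) hx,
    diff_mul hU hg.smooth hEf hx, diff_const]
  ring

/-- The left side is `X_f(X_g h) - X_g(X_f h)`. Expanding it and `X_{f,g}(h)` leaves only `Λ`- and
`E`-derivatives of functions in `𝔄(U)`, which the two structure equations compare. -/
theorem diff_lieBracket_hamiltonian (hU : IsOpen U) {f g h : M → ℝ} (hf : MemA J.bundle U f)
    (hg : MemA J.bundle U g) (hh : MemA J.bundle U h) {x : M} (hx : x ∈ U) :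
    diff h x (lieBracket (J.hamiltonian f) (J.hamiltonian g) x) =
      diff h x (J.hamiltonian (J.bracket f g) x) := by
  have hA : ∀ {f g}, MemA J.bundle U f → MemA J.bundle U g → MemA J.bundle U (J.apply f g) :=
    fun hf hg => J.apply_mem U hU _ _ hf hg
  have hE : ∀ {f}, MemA J.bundle U f → MemA J.bundle U (fieldApply J.reeb f) :=
    fun hf => J.reeb_mem U hU _ hf
  have hb := J.bracket_mem hU hf hg
  have comm : ∀ {f g}, MemA J.bundle U f → MemA J.bundle U g →
      J.apply f g x = - J.apply g f x := fun hf hg => J.apply_comm hU hf hg hx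
  rw [diff_lieBracket hU hh.smooth (J.isVectorFieldOn_hamiltonian hU hf)
      (J.isVectorFieldOn_hamiltonian hU hg) hx,
    J.diff_fieldApply_hamiltonian hU hg hh hx, J.diff_fieldApply_hamiltonian hU hf hh hx,
    J.diff_hamiltonian hU hh.smooth _ hx, comm hb hh]
  rw [J.diff_hamiltonian hU (hA hg hh).smooth _ hx, J.diff_hamiltonian hU hg.smooth _ hx,
    J.diff_hamiltonian hU (hE hh).smooth _ hx, J.diff_hamiltonian hU (hA hf hh).smooth _ hx,
    J.diff_hamiltonian hU hf.smooth _ hx, J.diff_hamiltonian hU (hE hh).smooth _ hx]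
  -- This is the product rule for `{f, g}` in the direction `Λ^♯ dh`. The bracket was moved to the
  -- second slot of `Λ` beforehand, because that is the slot where `apply` differentiates directly.
  have e : J.apply h (J.bracket f g) x = J.apply h (J.apply f g) x +
      (J.apply h f x * fieldApply J.reeb g x + f x * J.apply h (fieldApply J.reeb g) x) -
      (J.apply h g x * fieldApply J.reeb f x + g x * J.apply h (fieldApply J.reeb f) x) :=
    J.diff_bracket hU hf hg hx _
  have s := J.schouten_eq U hU f g h hf hg hh x hx
  have l1 := J.lieDeriv_eq U hU g h hg hh x hx
  have l2 := J.lieDeriv_eq U hU f h hf hh x hx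
  have b : J.bracket f g x =
    J.apply f g x + f x * fieldApply J.reeb g x - g x * fieldApply J.reeb f x := rfl
  simp only [schouten, derivComp, wedge, lieDeriv, Pi.add_apply, Pi.sub_apply, Pi.mul_apply]
    at s l1 l2
  rw [e, b]
  -- The factor `1 / 2` is there because `[Λ, Λ]` counts the composition twice. `L_E Λ = 0` enters
  -- with weight `f` on `(g, h)` and `-g` on `(f, h)`; the `comm` terms only reorder arguments.
  linear_combination comm hf (hA hg hh) - comm hg (hA hf hh) + comm hh (hA hf hg)
    + fieldApply J.reeb g x * comm hh hf + f x * comm hh (hE hg)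
    - fieldApply J.reeb f x * comm hh hg - g x * comm hh (hE hf)
    - fieldApply J.reeb h x * comm hg hf + f x * l1 - g x * l2 - (1 / 2) * s

/-- The Hamiltonian vector fields satisfy `[X_f, X_g] = X_{f, g}`. -/
theorem lieBracket_hamiltonian (hsep : J.bundle.Separating) (hU : IsOpen U) {f g : M → ℝ}
    (hf : MemA J.bundle U f) (hg : MemA J.bundle U g) {x : M} (hx : x ∈ U) :
    lieBracket (J.hamiltonian f) (J.hamiltonian g) x = J.hamiltonian (J.bracket f g) x :=
  hsep.eq hU hx fun _ hV hVU hxV _ hh =>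
    J.diff_lieBracket_hamiltonian hV (hf.mono hVU) (hg.mono hVU) hh hxV

end PartialJacobi

/-! ### Involutivity -/

theorem diff_sum {ι : Type*} (s : Finset ι) (hU : IsOpen U) {f : ι → M → ℝ}
    (hf : ∀ i, SmoothFun E U (f i)) {x : M} (hx : x ∈ U) (v : E) :
    diff (fun z => ∑ i ∈ s, f i z) x v = ∑ i ∈ s, diff (f i) x v := by
  classical
  induction s using Finset.induction_on with
  | empty => simpa using diff_const (E := E) 0 x v
  | insert i s hi ih =>
    simp only [Finset.sum_insert hi]
    rw [diff_add hU (hf i) (SmoothFun.sum fun j _ => hf j) hx, ih]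

theorem diff_sum_smul {ι : Type*} [Fintype ι] (hU : IsOpen U) {f : M → ℝ}
    (hf : SmoothFun E U f) {x : M} (hx : x ∈ U) (a : ι → ℝ) (w : ι → E) :
    diff f x (∑ i, a i • w i) = ∑ i, a i * diff f x (w i) := by
  have hl := isLinearMap_diff hU hf hx
  refine (map_sum (IsLinearMap.mk' _ hl) _ _).trans (Finset.sum_congr rfl fun i _ => ?_)
  exact hl.map_smul _ _

theorem diff_fieldApply_sum {ι : Type*} [Fintype ι] (hU : IsOpen U) {φ : M → ℝ}
    (hφ : SmoothFun E U φ) {k : ι → M → ℝ} (hk : ∀ i, SmoothFun E U (k i)) {X : ι → M → E}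
    (hX : ∀ i, IsVectorFieldOn U (X i)) {Y : M → E} (hY : ∀ x ∈ U, Y x = ∑ i, k i x • X i x)
    {x : M} (hx : x ∈ U) (v : E) :
    diff (fieldApply Y φ) x v =
      ∑ i, (diff (k i) x v * diff φ x (X i x) + k i x * diff (fieldApply (X i) φ) x v) := by
  have h : ∀ z ∈ U, fieldApply Y φ z = ∑ i, k i z * fieldApply (X i) φ z := fun z hz => by
    unfold fieldApply
    rw [hY z hz, diff_sum_smul hU hφ hz]
  rw [diff_congr hU h hx, diff_sum _ hU
    (fun i => (hk i).mul (smoothFun_fieldApply hU hφ (hX i))) hx]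
  refine Finset.sum_congr rfl fun i _ => ?_
  rw [diff_mul hU (hk i) (smoothFun_fieldApply hU hφ (hX i)) hx]
  exact congrArg (· + _) rfl

theorem isVectorFieldOn_of_eq_sum {ι : Type*} [Fintype ι] {k : ι → M → ℝ}
    (hk : ∀ i, SmoothFun E U (k i)) {X : ι → M → E} (hX : ∀ i, IsVectorFieldOn U (X i))
    {Y : M → E} (hY : ∀ x ∈ U, Y x = ∑ i, k i x • X i x) : IsVectorFieldOn U Y :=
  (IsVectorFieldOn.sum fun i _ => IsVectorFieldOn.smul (hk i) (hX i)).congr hY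

/-- The bracket of two combinations of vector fields. -/
theorem lieBracket_eq_sum {T : WeakSubbundle E M F} (hT : T.Separating) (hU : IsOpen U)
    {ι κ : Type*} [Fintype ι] [Fintype κ]
    {h : ι → M → ℝ} (hh : ∀ i, SmoothFun E U (h i)) {X : ι → M → E}
    (hX : ∀ i, IsVectorFieldOn U (X i)) {Y : M → E} (hY : ∀ x ∈ U, Y x = ∑ i, h i x • X i x)
    {k : κ → M → ℝ} (hk : ∀ j, SmoothFun E U (k j)) {Z : κ → M → E}
    (hZ : ∀ j, IsVectorFieldOn U (Z j)) {W : M → E} (hW : ∀ x ∈ U, W x = ∑ j, k j x • Z j x)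
    {x : M} (hx : x ∈ U) :
    lieBracket Y W x = (∑ i, ∑ j, (h i x * k j x) • lieBracket (X i) (Z j) x) +
      ((∑ j, fieldApply Y (k j) x • Z j x) + ∑ i, (- fieldApply W (h i) x) • X i x) := by
  refine hT.eq hU hx fun V hV hVU hxV φ hφ => ?_
  have hh' := fun i => (hh i).mono hVU
  have hk' := fun j => (hk j).mono hVU
  have hX' := fun i => (hX i).mono hVU
  have hZ' := fun j => (hZ j).mono hVU
  have hY' := fun z hz => hY z (hVU hz)
  have hW' := fun z hz => hW z (hVU hz)
  have hlie : ∀ i j, diff φ x (lieBracket (X i) (Z j) x) =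
      diff (fieldApply (Z j) φ) x (X i x) - diff (fieldApply (X i) φ) x (Z j x) := fun i j =>
    diff_lieBracket hV hφ.smooth (hX' i) (hZ' j) hxV
  have hP : ∀ j, diff (fieldApply (Z j) φ) x (Y x) =
      ∑ i, h i x * diff (fieldApply (Z j) φ) x (X i x) := fun j => by
    rw [hY x hx, diff_sum_smul hV (smoothFun_fieldApply hV hφ.smooth (hZ' j)) hxV]
  have hQ : ∀ i, diff (fieldApply (X i) φ) x (W x) =
      ∑ j, k j x * diff (fieldApply (X i) φ) x (Z j x) := fun i => by
    rw [hW x hx, diff_sum_smul hV (smoothFun_fieldApply hV hφ.smooth (hX' i)) hxV]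
  have hl := isLinearMap_diff hV hφ.smooth hxV
  -- These terms differentiate only `Xᵢ(φ)` and `Zⱼ(φ)`, not the coefficients; they assemble into
  -- the brackets `[Xᵢ, Zⱼ]`. What remains comes from the derivatives of the coefficients.
  have hdbl : diff φ x (∑ i, ∑ j, (h i x * k j x) • lieBracket (X i) (Z j) x) =
      ∑ j, k j x * (∑ i, h i x * diff (fieldApply (Z j) φ) x (X i x)) -
        ∑ i, h i x * (∑ j, k j x * diff (fieldApply (X i) φ) x (Z j x)) := by
    rw [← Fintype.sum_prod_type' (fun i j => (h i x * k j x) • lieBracket (X i) (Z j) x),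
      diff_sum_smul hV hφ.smooth hxV, Fintype.sum_prod_type]
    simp only [hlie, mul_sub, Finset.sum_sub_distrib, Finset.mul_sum]
    rw [Finset.sum_comm]
    simp only [mul_left_comm, mul_assoc]
  rw [diff_lieBracket hV hφ.smooth (isVectorFieldOn_of_eq_sum hh' hX' hY')
      (isVectorFieldOn_of_eq_sum hk' hZ' hW') hxV,
    diff_fieldApply_sum hV hφ.smooth hk' hZ' hW' hxV,
    diff_fieldApply_sum hV hφ.smooth hh' hX' hY' hxV, hl.map_add, hl.map_add, hdbl,
    diff_sum_smul hV hφ.smooth hxV, diff_sum_smul hV hφ.smooth hxV]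
  simp only [hP, hQ, Finset.sum_add_distrib, neg_mul, Finset.sum_neg_distrib, fieldApply]
  ring

theorem IsGeneratedSection.of_fintype {G : Set (M → E)} {ι : Type*} [Fintype ι]
    {h : ι → M → ℝ} {X : ι → M → E} {Y : M → E} (hh : ∀ i, SmoothFun E U (h i))
    (hX : ∀ i, X i ∈ G) (hY : ∀ x ∈ U, Y x = ∑ i, h i x • X i x) : IsGeneratedSection G U Y := by
  let e := Fintype.equivFin ι
  refine ⟨Fintype.card ι, fun i => h (e.symm i), fun i => X (e.symm i), fun i => hh _,
    fun i => hX _, fun x hx => ?_⟩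
  rw [hY x hx]
  exact (e.symm.sum_comp fun i => h i x • X i x).symm

theorem IsGeneratedSection.mem {G : Set (M → E)} {Y : M → E} (hY : IsGeneratedSection G U Y)
    {x : M} (hx : x ∈ U) : Y x ∈ generatedDistribution G x := by
  obtain ⟨n, h, X, -, hX, he⟩ := hY
  rw [he x hx]
  exact Submodule.sum_mem _ fun i _ =>
    Submodule.smul_mem _ _ (Submodule.subset_span ⟨X i, hX i, rfl⟩)

theorem PartialJacobi.isInvolutive (J : PartialJacobi E M F) (hsep : J.bundle.Separating) :
    IsInvolutive J.hamiltonianFields := by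
  intro U hU Y Z hY hZ
  suffices h : IsGeneratedSection J.hamiltonianFields U (lieBracket Y Z) from
    ⟨h, fun x hx => h.mem hx⟩
  obtain ⟨n, h, X, hh, hX, hYe⟩ := hY
  obtain ⟨m, k, V, hk, hV, hZe⟩ := hZ
  choose f hf hXf using hX
  choose g hg hVg using hV
  have hXs : ∀ i, IsVectorFieldOn U (X i) := fun i => by
    rw [hXf]
    exact J.isVectorFieldOn_hamiltonian hU ((hf i).mono (Set.subset_univ U))
  have hVs : ∀ i, IsVectorFieldOn U (V i) := fun i => by
    rw [hVg]
    exact J.isVectorFieldOn_hamiltonian hU ((hg i).mono (Set.subset_univ U))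
  have hYs := isVectorFieldOn_of_eq_sum hh hXs hYe
  have hZs := isVectorFieldOn_of_eq_sum hk hVs hZe
  -- Pairs index the fields `[Xᵢ, Vⱼ]`, with coefficient `hᵢ kⱼ`; the other summands index the
  -- original generators, with the coefficients `Y(kⱼ)` and `-Z(hᵢ)` produced by the Leibniz rule.
  refine IsGeneratedSection.of_fintype (ι := (Fin n × Fin m) ⊕ (Fin m ⊕ Fin n))
    (h := Sum.elim (fun p x => h p.1 x * k p.2 x)
      (Sum.elim (fun j => fieldApply Y (k j)) fun i x => - fieldApply Z (h i) x))
    (X := Sum.elim (fun p => J.hamiltonian (J.bracket (f p.1) (g p.2))) (Sum.elim V X))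
    ?_ ?_ fun x hx => ?_
  · rintro (p | j | i)
    · exact (hh p.1).mul (hk p.2)
    · exact smoothFun_fieldApply hU (hk j) hYs
    · exact (smoothFun_fieldApply hU (hh i) hZs).neg
  · rintro (p | j | i)
    -- The generators come from functions on all of `M`, so their bracket lies in `𝔄(M)` and its
    -- Hamiltonian field is again a generator.
    · exact ⟨_, J.bracket_mem isOpen_univ (hf p.1) (hg p.2), rfl⟩
    · exact ⟨g j, hg j, hVg j⟩
    · exact ⟨f i, hf i, hXf i⟩
  · rw [lieBracket_eq_sum hsep hU hh hXs hYe hk hVs hZe hx]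
    simp only [Fintype.sum_sum_type, Fintype.sum_prod_type, Sum.elim_inl, Sum.elim_inr]
    congr 1
    refine Finset.sum_congr rfl fun i _ => Finset.sum_congr rfl fun j _ => ?_
    rw [hXf, hVg, J.lieBracket_hamiltonian hsep isOpen_univ (hf i) (hg j) (Set.mem_univ x)]

end JacobiManifold

end Convenient

end

theorem mainTheorem5
    {E : Type*} [AddCommGroup E] [Module ℝ E] [TopologicalSpace E] [Convenient.ConvenientSpace E]
    {M : Type*} [TopologicalSpace M] [ChartedSpace (Convenient.CInf E) M]
    [Convenient.ConvenientManifold E M]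
    {F : Type*} [AddCommGroup F] [Module ℝ F] [TopologicalSpace F] [Convenient.ConvenientSpace F]
    (J : Convenient.PartialJacobi E M F) (hsep : J.bundle.Separating) :
    (∀ U : Set M, IsOpen U → ∀ f g : M → ℝ,
      Convenient.MemA J.bundle U f → Convenient.MemA J.bundle U g →
        Convenient.MemA J.bundle U (J.bracket f g) ∧
        Convenient.IsVectorFieldOn U (J.hamiltonian f) ∧
        ∀ x ∈ U, Convenient.lieBracket (J.hamiltonian f) (J.hamiltonian g) x =
          J.hamiltonian (J.bracket f g) x) ∧
    Convenient.IsInvolutive J.hamiltonianFields :=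
  ⟨fun _ hU _ _ hf hg => ⟨J.bracket_mem hU hf hg, J.isVectorFieldOn_hamiltonian hU hf,
    fun _ hx => J.lieBracket_hamiltonian hsep hU hf hg hx⟩, J.isInvolutive hsep⟩
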